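/- Let $\mathcal X,\mathcal Z$ be measurable spaces such that $\mathcal X$ is countable or the $\sigma$-algebra of $\mathcal Z$ is countably generated (e.g. $\mathcal Z$ standard Borel), let $P_{Z|X}$ be a probability kernel from $\mathcal X$ to $\mathcal Z$, let $Q$ be a probability measure on $\mathcal Z$ and let $\alpha\in(1,\infty]$. The *Poisson private representation* (PPR) with parameter $\alpha$, proposal distribution $Q$ and simulated mechanism $P_{Z|X}$ acts on an input $X$ (deterministic or random, with $P_{Z|X}(\cdot|X)\ll Q$ almost surely) as follows. Let $Z_1,Z_2,\ldots$ be i.i.d. with distribution $Q$, and let $0<T_1<T_2<\cdots$ be a Poisson process with rate $1$, i.e. $T_1,T_2-T_1,T_3-T_2,\ldots$ are i.i.d. $\mathrm{Exp}(1)$, where $X$, $(Z_i)_i$ and $(T_i)_i$ are independent. Put $P:=P_{Z|X}(\cdot|X)$ and $\tilde T_i:=T_i\cdot\big(\frac{\mathrm dP}{\mathrm dQ}(Z_i)\big)^{-1}$ (with $\tilde T_i=\infty$ if $\frac{\mathrm dP}{\mathrm dQ}(Z_i)=0$; for random $X$, a jointly measurable version of the density is used). The message $K\in\{1,2,\ldots\}$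 is random, with conditional distribution $$\Pr\big(K=k\,\big|\,X,(Z_i)_i,(T_i)_i\big)=\frac{\tilde T_k^{-\alpha}}{\sum_{i\ge1}\tilde T_i^{-\alpha}}\qquad\text{if }\alpha<\infty,$$ and $K=\operatorname{argmin}_i\tilde T_i$ almost surely if $\alpha=\infty$. Let $\log$ be the logarithm to any fixed base $b>1$, used also in the Kullback–Leibler divergence $D$ and in the mutual information $I$ (both of which may be $+\infty$), and let $1/\infty=0$. **Theorem.** (i) If the input is a fixed $x\in\mathcal X$ and $P:=P_{Z|X}(\cdot|x)$, then $$\mathbb E[\log K]\le D(P\Vert Q)+\inf_{\eta\in(0,1]\cap(0,\alpha-1)}\frac1\eta\log\left(\frac{\Gamma\big(1-\frac{\eta+1}{\alpha}\big)\Gamma(\eta+1)}{\Gamma\big(1-\frac1\alpha\big)^{\eta+1}}+1\right)\le D(P\Vert Q)+\frac{\log(3.56)}{\min\{(\alpha-1)/2,\,1\}}.$$ (ii) If the input $X\sim P_X$ is random and $Q=P_Z$ is the marginal distribution of $Z$ under the joint distribution $P_XP_{Z|X}$ of $(X,Z)$, then $$\mathbb E[\log K]\le I(X;Z)+\frac{\log(3.56)}{\min\{(\alpha-1)/2,\,1\}}.$$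 -/

import Mathlib

open MeasureTheory ProbabilityTheory InformationTheory
open scoped ENNReal

noncomputable section

/-- The inter-arrival times `T₁, T₂ - T₁, T₃ - T₂, …` of a sequence `T₁, T₂, …`. -/
def interarrival (T : ℕ+ → ℝ) (k : ℕ+) : ℝ :=
  if k = 1 then T 1 else T k - T (k - 1)

section PPR

variable {Ω 𝒳 𝒵 : Type*} [MeasurableSpace Ω] [MeasurableSpace 𝒳] [MeasurableSpace 𝒵]

/-- `T₁ < T₂ < …` are the arrival times of a Poisson process with rate `1` on `[0, ∞)`:
the inter-arrival times are i.i.d. standard exponential variables. -/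
structure IsPoissonArrivals (μ : Measure Ω) (T : ℕ+ → Ω → ℝ) : Prop where
  measurable : ∀ i, Measurable (T i)
  law_interarrival : ∀ i,
    μ.map (fun ω => interarrival (fun j => T j ω) i) = expMeasure 1
  indep_interarrival : iIndepFun (fun (i : ℕ+) ω => interarrival (fun j => T j ω) i) μ

/-- `Z₁, Z₂, …` are i.i.d. with distribution `Q`. -/
structure IsIIDSample (μ : Measure Ω) (Q : Measure 𝒵) (Z : ℕ+ → Ω → 𝒵) : Prop where
  measurable : ∀ i, Measurable (Z i)
  law : ∀ i, μ.map (Z i) = Q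
  indep : iIndepFun Z μ

variable [MeasurableSpace.CountableOrCountablyGenerated 𝒳 𝒵]

/-- The rescaled time `t · (dP/dQ(z))⁻¹`, where `P = κ x` is the distribution of the output of
the mechanism `κ` on the input `x`; it is `∞` if `dP/dQ(z) = 0` (for `t > 0`).
`Kernel.rnDeriv κ (Kernel.const 𝒳 Q) x z` is the jointly measurable version of the
Radon-Nikodym derivative `d(κ x)/dQ (z)`. -/
def scaledTime (κ : Kernel 𝒳 𝒵) (Q : Measure 𝒵) (x : 𝒳) (z : 𝒵) (t : ℝ) : ℝ≥0∞ :=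
  ENNReal.ofReal t / Kernel.rnDeriv κ (Kernel.const 𝒳 Q) x z

/-- The probability `T̃ₖ ^ (-α) / ∑ᵢ T̃ᵢ ^ (-α)` that the index `k` is selected, given the
rescaled times `T̃₁, T̃₂, …`, for a finite parameter `α`. -/
def selectionProb (α : ℝ) (T' : ℕ+ → ℝ≥0∞) (k : ℕ+) : ℝ :=
  (T' k ^ (-α) / ∑' i, T' i ^ (-α)).toReal

/-- On the probability space `(Ω, μ)`, the message `K` is the one produced by the Poisson private
representation with parameter `α ∈ (1, ∞]`, proposal distribution `Q` and simulated mechanism `κ`,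
on the (possibly random) input `X`, with the shared randomness `Z₁, Z₂, …` and the Poisson
process `T₁, T₂, …` generated by the encoder. -/
structure IsPPR (μ : Measure Ω) (α : ℝ≥0∞) (κ : Kernel 𝒳 𝒵) (Q : Measure 𝒵)
    (X : Ω → 𝒳) (Z : ℕ+ → Ω → 𝒵) (T : ℕ+ → Ω → ℝ) (K : Ω → ℕ+) : Prop where
  measurable_input : Measurable X
  measurable_index : ∀ k, MeasurableSet (K ⁻¹' {k})
  sample : IsIIDSample μ Q Z
  arrivals : IsPoissonArrivals μ T
  /-- `(Tᵢ)ᵢ` is independent of `(Zᵢ)ᵢ` … -/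
  indep_sample_arrivals : IndepFun (fun ω i => Z i ω) (fun ω i => T i ω) μ
  /-- … and the pair is independent of the input. -/
  indep_input : IndepFun X (fun ω => (fun i => Z i ω, fun i => T i ω)) μ
  /-- The regularity condition on the mechanism. -/
  absolutelyContinuous : ∀ᵐ ω ∂μ, κ (X ω) ≪ Q
  /-- For `α < ∞`, the conditional distribution of `K` given the input, the samples and the
  arrival times. -/
  condDistrib_index : α ≠ ∞ → ∀ k : ℕ+,
    μ[(K ⁻¹' {k}).indicator (fun _ => (1 : ℝ)) |
        MeasurableSpace.comap (fun ω => (X ω, fun i => Z i ω, fun i => T i ω))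
          (inferInstance : MeasurableSpace (𝒳 × (ℕ+ → 𝒵) × (ℕ+ → ℝ)))]
      =ᵐ[μ] fun ω =>
        selectionProb α.toReal (fun i => scaledTime κ Q (X ω) (Z i ω) (T i ω)) k
  /-- For `α = ∞`, the index `K` attains the minimum of the rescaled times. -/
  argmin_index : α = ∞ → ∀ᵐ ω ∂μ, ∀ i : ℕ+,
    scaledTime κ Q (X ω) (Z (K ω) ω) (T (K ω) ω) ≤ scaledTime κ Q (X ω) (Z i ω) (T i ω)

end PPR

section Information

variable {Ω 𝒳 𝒵 : Type*} [MeasurableSpace Ω] [MeasurableSpace 𝒳] [MeasurableSpace 𝒵]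

/-- `E[log K]` with logarithm to the base `b > 1`; the integrand is nonnegative as `K ≥ 1`. -/
def expectedLog (b : ℝ) (μ : Measure Ω) (K : Ω → ℕ+) : ℝ≥0∞ :=
  ∫⁻ ω, ENNReal.ofReal (Real.logb b ((K ω : ℕ) : ℝ)) ∂μ

/-- The Kullback-Leibler divergence `D(P‖Q)` of probability measures, with logarithm to the
base `b > 1` (`klDiv` uses the natural logarithm). -/
def klDivBase (b : ℝ) (P Q : Measure 𝒵) : ℝ≥0∞ :=
  klDiv P Q / ENNReal.ofReal (Real.log b)

/-- The mutual information `I(X;Z)`, with logarithm to the base `b > 1`, of a pair `(X, Z)` with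
joint distribution `ρ`. -/
def mutualInfo (b : ℝ) (ρ : Measure (𝒳 × 𝒵)) : ℝ≥0∞ :=
  klDivBase b ρ (ρ.fst.prod ρ.snd)

/-- `inf_η (1/η) log (Γ(1 - (η+1)/α) Γ(η+1) / Γ(1 - 1/α)^(η+1) + 1)` over
`η ∈ (0, 1] ∩ (0, α - 1)`, with logarithm to the base `b > 1`, for `α ∈ (1, ∞]` and `1/∞ = 0`.
The expression under the infimum is nonnegative. -/
def gammaBound (b : ℝ) (α : ℝ≥0∞) : ℝ≥0∞ :=
  ⨅ η ∈ {η : ℝ | 0 < η ∧ η ≤ 1 ∧ ENNReal.ofReal η < α - 1},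
    ENNReal.ofReal ((1 / η) * Real.logb b
      (Real.Gamma (1 - (η + 1) * (α⁻¹).toReal) * Real.Gamma (η + 1)
        / Real.Gamma (1 - (α⁻¹).toReal) ^ (η + 1) + 1))

/-- `log(3.56) / min {(α - 1)/2, 1}`, with logarithm to the base `b > 1`, for `α ∈ (1, ∞]`. -/
def simpleBound (b : ℝ) (α : ℝ≥0∞) : ℝ≥0∞ :=
  ENNReal.ofReal (Real.logb b 3.56) / min ((α - 1) / 2) 1

end Information

end

/-! Write P = r·Q, and call T_K the arrival time of the selected point. The points (Tᵢ, Zᵢ) form a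
Poisson process with intensity ds Q(dz). Everything rests on Mecke's formula
`tsum_lintegral_markedLaw_removeAt`: summing over the points a function of the point and of the
remaining configuration has the same mean as adding a point at (s, z), integrated over ds Q(dz).

The index. K - 1 counts the points before the selected one. Deleting such a point can only raise the
selection probabilities of the others, so Mecke's formula gives E[(K-1) φ(T_K)] ≤ E[T_K φ(T_K)]
(`IsSelectionRule.lintegral_index_le`). With φ(t) = 1/(1+t) and log x ≤ x - 1 at x = K/(1+T_K), this
becomes E log K ≤ E log(1 + T_K).

The time. Rescaling by r turns the intensity into dt P(dz). If d(t) bounds the probability that a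
point added at rescaled time t is selected, then E h(T_K) ≤ ∫ P(dz) ∫ h(r(z) t) d(t) dt
(`IsSelectionRule.lintegral_time_le`). For α = ∞ one takes d(t) = e⁻ᵗ. For α < ∞ one needs the
Laplace transform of the sum of the weights, which is a stable variable. Both cases follow from
upper bounds on Laplace functionals, obtained by increasing the test function gradually: Mecke's
formula controls each step (`lintegral_expNeg_tsum_mul_le`), and a discrete Grönwall argument
collects the steps. In both cases d is a probability density whose η-th moment C is the ratio of
Gamma values in the theorem.

The divergence. From 1 + rt ≤ (1 + (rt)^η)^(1/η) and rt = (r^η t^η)^(1/η), log(1 + rt) is at most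
log r + log(r^(-η) + t^η)/η. Under P and d the mean of r^(-η) + t^η is at most 1 + C, so concavity
of log yields D(P‖Q) + log(1+C)/η (`mul_log_one_add_mul_le`).

A random input is independent of the points, so the fixed-input bound can be averaged; the mean
divergence from the marginal of Z is I(X;Z). Convexity of Γ gives C ≤ 2.56 at η = min{(α-1)/2, 1}.
-/

/-! ### Deleting and inserting a term of a sequence; invariance of i.i.d. laws. -/

section Sequences

/-- The increasing enumeration of the natural numbers different from `j`. -/
def skipIndex (j n : ℕ) : ℕ := if n < j then n else n + 1

/-- The sequence `f` with its `j`-th term removed. -/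
def removeAt {β : Type*} (j : ℕ) (f : ℕ → β) : ℕ → β := fun n => f (skipIndex j n)

/-- The sequence `f` with `u` inserted as its `j`-th term. -/
def insertAt {β : Type*} (j : ℕ) (u : β) (f : ℕ → β) : ℕ → β :=
  fun n => if n = j then u else f (if n < j then n else n - 1)

lemma skipIndex_injective (j : ℕ) : Function.Injective (skipIndex j) := by
  intro m n h
  simp only [skipIndex] at h
  split_ifs at h <;> omega

lemma skipIndex_ne (j n : ℕ) : skipIndex j n ≠ j := by
  simp only [skipIndex]
  split_ifs <;> omega

lemma exists_skipIndex_eq {j m : ℕ} (h : m ≠ j) : ∃ n, skipIndex j n = m := by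
  by_cases hm : m < j
  · exact ⟨m, by simp [skipIndex, hm]⟩
  · refine ⟨m - 1, ?_⟩
    simp only [skipIndex]
    split_ifs <;> omega

variable {β : Type*}

@[simp] lemma insertAt_self (j : ℕ) (u : β) (f : ℕ → β) : insertAt j u f j = u := by
  simp [insertAt]

@[simp] lemma insertAt_skipIndex (j n : ℕ) (u : β) (f : ℕ → β) :
    insertAt j u f (skipIndex j n) = f n := by
  simp only [insertAt, skipIndex_ne, if_false]
  congr 1
  simp only [skipIndex]
  split_ifs <;> omega

@[simp] lemma removeAt_insertAt (j : ℕ) (u : β) (f : ℕ → β) :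
    removeAt j (insertAt j u f) = f := by
  funext n
  simp [removeAt]

/-- Needed for a selected point with a later index than the deleted one: the deletion at `j` shifts
index `k + 1` to `k`. -/
lemma removeAt_removeAt {j k : ℕ} (h : j < k + 1) (f : ℕ → β) :
    removeAt k (removeAt j f) = removeAt j (removeAt (k + 1) f) := by
  funext n
  simp only [removeAt, skipIndex]
  congr 1
  split_ifs <;> omega

lemma tsum_eq_add_tsum_removeAt (f : ℕ → ℝ≥0∞) (j : ℕ) :
    ∑' n, f n = f j + ∑' n, removeAt j f n := by
  rw [ENNReal.tsum_eq_add_tsum_ite j]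
  congr 1
  have := (skipIndex_injective j).tsum_eq (f := fun n => if n = j then 0 else f n) (by
    intro m hm
    obtain ⟨n, rfl⟩ := exists_skipIndex_eq (j := j) (m := m) (by
      rintro rfl
      simp at hm)
    exact ⟨n, rfl⟩)
  simp only [skipIndex_ne, if_false] at this
  convert this.symm
  rfl

variable [MeasurableSpace β]

@[fun_prop]
lemma measurable_removeAt (j : ℕ) : Measurable (removeAt j : (ℕ → β) → ℕ → β) := by
  unfold removeAt
  fun_prop

@[fun_prop]
lemma measurable_insertAt (j : ℕ) :
    Measurable (fun p : β × (ℕ → β) => insertAt j p.1 p.2) := by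
  rw [measurable_pi_iff]
  intro n
  simp only [insertAt]
  split_ifs <;> fun_prop

/-- Inserting an independent term into an i.i.d. sequence yields an i.i.d. sequence. -/
lemma map_insertAt (ρ : Measure β) [IsProbabilityMeasure ρ] (j : ℕ) :
    (ρ.prod (Measure.infinitePi fun _ : ℕ => ρ)).map (fun p => insertAt j p.1 p.2)
      = Measure.infinitePi fun _ : ℕ => ρ := by
  classical
  refine Measure.eq_infinitePi _ fun s t ht => ?_
  rw [Measure.map_apply (measurable_insertAt j)
    (MeasurableSet.pi s.countable_toSet fun i _ => ht i)]
  set s' : Finset ℕ := s.preimage (skipIndex j) (skipIndex_injective j).injOn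
  have hpre : (fun p : β × (ℕ → β) => insertAt j p.1 p.2) ⁻¹' (Set.pi s t)
      = (if j ∈ s then t j else Set.univ) ×ˢ Set.pi s' fun n => t (skipIndex j n) := by
    ext ⟨u, f⟩
    simp only [Set.mem_preimage, Set.mem_pi, Set.mem_prod]
    constructor
    · intro h
      refine ⟨?_, fun n hn => ?_⟩
      · split_ifs with hj
        · simpa using h j hj
        · trivial
      · simpa using h (skipIndex j n) (by simpa [s'] using hn)
    · rintro ⟨h1, h2⟩ m hm
      by_cases hmj : m = j
      · subst hmj
        rw [if_pos (by simpa using hm)] at h1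
        simpa using h1
      · obtain ⟨n, rfl⟩ := exists_skipIndex_eq hmj
        simpa using h2 n (by simpa [s'] using hm)
  rw [hpre, Measure.prod_prod, Measure.infinitePi_pi _ fun i _ => ht _,
    Finset.prod_preimage' (skipIndex j) s (skipIndex_injective j).injOn fun m => ρ (t m)]
  have hfilter : s.filter (fun m => m ∈ Set.range (skipIndex j)) = s.erase j := by
    ext m
    simp only [Finset.mem_filter, Set.mem_range, Finset.mem_erase]
    constructor
    · rintro ⟨h, n, rfl⟩
      exact ⟨skipIndex_ne j n, h⟩
    · rintro ⟨h, h'⟩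
      exact ⟨h', exists_skipIndex_eq h⟩
  rw [hfilter]
  split_ifs with hj
  · exact Finset.mul_prod_erase s (fun m => ρ (t m)) hj
  · simp [Finset.erase_eq_of_notMem hj]

lemma lintegral_infinitePi_insertAt (ρ : Measure β) [IsProbabilityMeasure ρ] (j : ℕ)
    {F : (ℕ → β) → ℝ≥0∞} (hF : Measurable F) :
    ∫⁻ f, F f ∂(Measure.infinitePi fun _ : ℕ => ρ)
      = ∫⁻ u, ∫⁻ f, F (insertAt j u f) ∂(Measure.infinitePi fun _ : ℕ => ρ) ∂ρ := by
  conv_lhs => rw [← map_insertAt ρ j]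
  rw [lintegral_map hF (measurable_insertAt j),
    lintegral_prod (fun p : β × (ℕ → β) => F (insertAt j p.1 p.2))
      (hF.comp (measurable_insertAt j)).aemeasurable]

end Sequences

/-! ### Exponential gaps and the law of the arrivals after one deletion. -/

section Arrivals

lemma lintegral_expMeasure_one {F : ℝ → ℝ≥0∞} (hF : Measurable F) :
    ∫⁻ x, F x ∂(expMeasure 1) = ∫⁻ x in Set.Ioi 0, ENNReal.ofReal (Real.exp (-x)) * F x := by
  have hpdf : Measurable (exponentialPDF 1) := (measurable_exponentialPDFReal 1).ennreal_ofReal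
  change ∫⁻ x, F x ∂(volume.withDensity (exponentialPDF 1)) = _
  rw [lintegral_withDensity_eq_lintegral_mul _ hpdf hF, setLIntegral_congr Ioi_ae_eq_Ici,
    ← lintegral_indicator measurableSet_Ici]
  refine lintegral_congr fun x => ?_
  by_cases hx : 0 ≤ x
  · simp [exponentialPDF_eq, hx]
  · simp [exponentialPDF_eq, hx]

lemma ae_expMeasure_one_pos : ∀ᵐ x ∂(expMeasure 1), 0 < x := by
  rw [ae_iff]
  have hS : MeasurableSet {x : ℝ | ¬ 0 < x} := by measurability
  rw [← lintegral_indicator_one hS, lintegral_expMeasure_one (measurable_one.indicator hS),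
    setLIntegral_congr_fun (g := fun _ => 0) measurableSet_Ioi]
  · simp
  · intro x hx
    simp [Set.mem_Ioi.1 hx]

/-- The joint density of `u` and `x = u + v` on `0 < u ≤ x` is e⁻ˣ, free of `u`. So the total has
the weight of one exponential gap, and the split point runs over that gap with (unnormalised)
Lebesgue measure. This is the source of Mecke's formula. -/
lemma lintegral_expMeasure_one_add {H : ℝ → ℝ → ℝ≥0∞} (hH : Measurable (Function.uncurry H)) :
    ∫⁻ u, ∫⁻ v, H u (u + v) ∂(expMeasure 1) ∂(expMeasure 1)
      = ∫⁻ x, (∫⁻ u in Set.Ioc 0 x, H u x) ∂(expMeasure 1) := by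
  have : IsProbabilityMeasure (expMeasure 1) := isProbabilityMeasure_expMeasure one_pos
  have hm : ∀ {f g : ℝ × ℝ → ℝ}, Measurable f → Measurable g →
      Measurable fun p => H (f p) (g p) := fun hf hg => hH.comp (hf.prodMk hg)
  set D : ℝ → ℝ → ℝ≥0∞ := fun u x =>
    if 0 < u ∧ u ≤ x then ENNReal.ofReal (Real.exp (-x)) * H u x else 0 with hD
  have hDm : Measurable (Function.uncurry D) := by
    refine Measurable.ite ?_ (.mul (by fun_prop) hH) measurable_const
    exact (measurableSet_lt measurable_const measurable_fst).inter
      (measurableSet_le measurable_fst measurable_snd)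
  have hl : ∀ u, ∫⁻ v, H u (u + v) ∂(expMeasure 1)
      = ∫⁻ x in Set.Ici u, ENNReal.ofReal (Real.exp (-(x - u))) * H u x := by
    intro u
    have hHu : Measurable (H u) := hH.comp measurable_prodMk_left
    rw [lintegral_expMeasure_one (F := fun v => H u (u + v)) (hHu.comp (measurable_const_add u)),
      setLIntegral_congr Ioi_ae_eq_Ici, ← lintegral_indicator measurableSet_Ici,
      ← lintegral_indicator measurableSet_Ici,
      ← lintegral_add_left_eq_self
        ((Set.Ici u).indicator fun x => ENNReal.ofReal (Real.exp (-(x - u))) * H u x) u]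
    refine lintegral_congr fun v => ?_
    simp [Set.indicator_apply]
  have hlm : Measurable fun u => ∫⁻ v, H u (u + v) ∂(expMeasure 1) :=
    Measurable.lintegral_prod_right'
      (f := fun p : ℝ × ℝ => H p.1 (p.1 + p.2)) (hm measurable_fst (by fun_prop))
  have hrm : Measurable fun x => ∫⁻ u in Set.Ioc 0 x, H u x := by
    simp_rw [← lintegral_indicator measurableSet_Ioc]
    refine Measurable.lintegral_prod_right'
      (f := fun p : ℝ × ℝ => (Set.Ioc 0 p.1).indicator (fun u => H u p.1) p.2) ?_
    simp only [Set.indicator_apply, Set.mem_Ioc]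
    refine Measurable.ite ?_ (hm measurable_snd measurable_fst) measurable_const
    exact (measurableSet_lt measurable_const measurable_snd).inter
      (measurableSet_le measurable_snd measurable_fst)
  rw [lintegral_expMeasure_one hlm, lintegral_expMeasure_one hrm,
    ← lintegral_indicator measurableSet_Ioi, ← lintegral_indicator measurableSet_Ioi]
  trans ∫⁻ u, ∫⁻ x, D u x
  · refine lintegral_congr fun u => ?_
    by_cases hu : 0 < u
    · rw [Set.indicator_of_mem (Set.mem_Ioi.2 hu), hl,
        ← lintegral_const_mul' _ _ ENNReal.ofReal_ne_top, ← lintegral_indicator measurableSet_Ici]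
      refine lintegral_congr fun x => ?_
      simp only [hD, Set.indicator_apply, Set.mem_Ici, hu, true_and]
      split_ifs
      · rw [← mul_assoc, ← ENNReal.ofReal_mul (Real.exp_nonneg _), ← Real.exp_add]
        ring_nf
      · rfl
    · simp [hD, hu]
  · rw [lintegral_lintegral_swap hDm.aemeasurable]
    refine lintegral_congr fun x => ?_
    by_cases hx : 0 < x
    · rw [Set.indicator_of_mem (Set.mem_Ioi.2 hx), ← lintegral_const_mul' _ _ ENNReal.ofReal_ne_top,
        ← lintegral_indicator measurableSet_Ioc]
      refine lintegral_congr fun u => ?_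
      simp [hD, Set.indicator_apply]
    · rw [Set.indicator_of_notMem (by simpa using hx)]
      simp only [hD]
      rw [lintegral_congr (g := fun _ => 0), lintegral_zero]
      intro u
      rw [if_neg]
      rintro ⟨h1, h2⟩
      exact hx (h1.trans_le h2)

/-- The arrival times `e₀, e₀ + e₁, …` with inter-arrival times `e₀, e₁, …`. -/
noncomputable def arrivalTimes (e : ℕ → ℝ) (n : ℕ) : ℝ := ∑ i ∈ Finset.range (n + 1), e i

@[fun_prop]
lemma measurable_arrivalTimes : Measurable arrivalTimes := by
  unfold arrivalTimes
  fun_prop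

lemma sum_range_insertAt_of_le {j m : ℕ} (h : m ≤ j) (u : ℝ) (f : ℕ → ℝ) :
    ∑ i ∈ Finset.range m, insertAt j u f i = ∑ i ∈ Finset.range m, f i := by
  refine Finset.sum_congr rfl fun i hi => ?_
  have hij : i < j := (Finset.mem_range.1 hi).trans_le h
  simp [insertAt, hij.ne, hij]

lemma sum_range_succ_insertAt {j m : ℕ} (h : j ≤ m) (u : ℝ) (f : ℕ → ℝ) :
    ∑ i ∈ Finset.range (m + 1), insertAt j u f i = u + ∑ i ∈ Finset.range m, f i := by
  induction m, h using Nat.le_induction with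
  | base => rw [Finset.sum_range_succ, sum_range_insertAt_of_le le_rfl, insertAt_self, add_comm]
  | succ m hm ih =>
    rw [Finset.sum_range_succ, ih, Finset.sum_range_succ _ m, ← add_assoc]
    congr 1
    have h1 : ¬ m + 1 < j := by omega
    have h2 : m + 1 ≠ j := by omega
    simp [insertAt, h1, h2]

lemma arrivalTimes_insertAt_insertAt_self (j : ℕ) (u v : ℝ) (e : ℕ → ℝ) :
    arrivalTimes (insertAt j u (insertAt j v e)) j = (∑ i ∈ Finset.range j, e i) + u := by
  rw [arrivalTimes, sum_range_succ_insertAt le_rfl, sum_range_insertAt_of_le le_rfl, add_comm]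

/-- Deleting an arrival merges the two gaps next to it. -/
lemma removeAt_arrivalTimes_insertAt_insertAt (j : ℕ) (u v : ℝ) (e : ℕ → ℝ) :
    removeAt j (arrivalTimes (insertAt j u (insertAt j v e)))
      = arrivalTimes (insertAt j (u + v) e) := by
  funext n
  simp only [removeAt, skipIndex, arrivalTimes]
  split_ifs with h
  · rw [sum_range_insertAt_of_le h, sum_range_insertAt_of_le h, sum_range_insertAt_of_le h]
  · have h' : j ≤ n := not_lt.1 h
    rw [sum_range_succ_insertAt (h'.trans n.le_succ), sum_range_succ_insertAt h',
      sum_range_succ_insertAt h', add_assoc]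

instance : IsProbabilityMeasure (expMeasure 1) := isProbabilityMeasure_expMeasure one_pos

/-- The law of the arrival times of a Poisson process with rate `1`. -/
noncomputable def arrivalLaw : Measure (ℕ → ℝ) :=
  (Measure.infinitePi fun _ : ℕ => expMeasure 1).map arrivalTimes

instance : IsProbabilityMeasure arrivalLaw :=
  Measure.isProbabilityMeasure_map measurable_arrivalTimes.aemeasurable

/-- Two independent gaps are split off at position `j`. After the deletion the other arrivals see
only their sum, so `lintegral_expMeasure_one_add` replaces the two by a single exponential gap
through which the deleted time runs. -/
lemma lintegral_arrivalLaw_removeAt (j : ℕ) {F : ℝ → (ℕ → ℝ) → ℝ≥0∞}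
    (hF : Measurable (Function.uncurry F)) :
    ∫⁻ t, F (t j) (removeAt j t) ∂arrivalLaw
      = ∫⁻ e : ℕ → ℝ, (∫⁻ s in Set.Ioc (∑ i ∈ Finset.range j, e i) (arrivalTimes e j),
          F s (arrivalTimes e)) ∂(Measure.infinitePi fun _ : ℕ => expMeasure 1) := by
  set ℙe := Measure.infinitePi fun _ : ℕ => expMeasure 1
  have hm : ∀ {γ : Type} [MeasurableSpace γ] {f : γ → ℝ} {g : γ → ℕ → ℝ}, Measurable f →
      Measurable g → Measurable fun p => F (f p) (g p) := fun hf hg => hF.comp (hf.prodMk hg)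
  have hm1 : Measurable fun e => F (arrivalTimes e j) (removeAt j (arrivalTimes e)) :=
    hm (by fun_prop) (by fun_prop)
  have hm2 : Measurable fun e : ℕ → ℝ => ∫⁻ s in Set.Ioc (∑ i ∈ Finset.range j, e i) (arrivalTimes e j),
          F s (arrivalTimes e) := by
    simp_rw [← lintegral_indicator measurableSet_Ioc]
    refine Measurable.lintegral_prod_right'
      (f := fun p : (ℕ → ℝ) × ℝ => (Set.Ioc (∑ i ∈ Finset.range j, p.1 i)
        (arrivalTimes p.1 j)).indicator (fun s => F s (arrivalTimes p.1)) p.2) ?_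
    simp only [Set.indicator_apply, Set.mem_Ioc]
    refine Measurable.ite ?_ (hm measurable_snd (by fun_prop)) measurable_const
    exact (measurableSet_lt (by fun_prop) measurable_snd).inter
      (measurableSet_le measurable_snd (by fun_prop))
  have hins2 : Measurable fun p : ℝ × (ℕ → ℝ) =>
      F (arrivalTimes (insertAt j p.1 p.2) j) (removeAt j (arrivalTimes (insertAt j p.1 p.2))) :=
    hm1.comp (measurable_insertAt j)
  rw [arrivalLaw, lintegral_map (hm (by fun_prop) (by fun_prop)) measurable_arrivalTimes,
    lintegral_infinitePi_insertAt _ j hm1, lintegral_infinitePi_insertAt _ j hm2]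
  have h1 : ∀ u, ∫⁻ e, F (arrivalTimes (insertAt j u e) j)
        (removeAt j (arrivalTimes (insertAt j u e))) ∂ℙe
      = ∫⁻ v, ∫⁻ e, F ((∑ i ∈ Finset.range j, e i) + u) (arrivalTimes (insertAt j (u + v) e)) ∂ℙe
          ∂(expMeasure 1) := by
    intro u
    rw [lintegral_infinitePi_insertAt _ j (F := fun e => F (arrivalTimes (insertAt j u e) j)
      (removeAt j (arrivalTimes (insertAt j u e)))) (hins2.comp measurable_prodMk_left)]
    simp_rw [arrivalTimes_insertAt_insertAt_self, removeAt_arrivalTimes_insertAt_insertAt]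
    rfl
  rw [lintegral_congr h1]
  have hm3 : Measurable fun p : (ℝ × ℝ) × (ℕ → ℝ) => F ((∑ i ∈ Finset.range j, p.2 i) + p.1.1)
      (arrivalTimes (insertAt j p.1.2 p.2)) :=
    hm (by fun_prop) (measurable_arrivalTimes.comp ((measurable_insertAt j).comp
      (measurable_fst.snd.prodMk measurable_snd)))
  rw [lintegral_expMeasure_one_add (H := fun u x => ∫⁻ e, F ((∑ i ∈ Finset.range j, e i) + u)
    (arrivalTimes (insertAt j x e)) ∂ℙe) (Measurable.lintegral_prod_right' hm3)]
  refine lintegral_congr fun x => ?_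
  have hm4 : Measurable (Function.uncurry fun (u : ℝ) (e : ℕ → ℝ) =>
      F ((∑ i ∈ Finset.range j, e i) + u) (arrivalTimes (insertAt j x e))) :=
    hm3.comp (f := fun p : ℝ × (ℕ → ℝ) => ((p.1, x), p.2)) (by fun_prop)
  rw [lintegral_lintegral_swap hm4.aemeasurable]
  refine lintegral_congr fun e => ?_
  have h2 : arrivalTimes (insertAt j x e) j = (∑ i ∈ Finset.range j, e i) + x := by
    rw [arrivalTimes, sum_range_succ_insertAt le_rfl, add_comm]
  rw [sum_range_insertAt_of_le le_rfl, h2, ← lintegral_indicator measurableSet_Ioc,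
    ← lintegral_indicator measurableSet_Ioc]
  -- Translation invariance turns the position inside the merged gap into an absolute time.
  conv_rhs => rw [← lintegral_add_left_eq_self _ (∑ i ∈ Finset.range j, e i)]
  refine lintegral_congr fun u => ?_
  simp [Set.indicator_apply]

end Arrivals

/-! ### Mecke's formula for the arrivals and for the marked process. -/

section Mecke

open Filter Topology

lemma measurable_uncurry_comp {α β γ δ : Type*} [MeasurableSpace α] [MeasurableSpace β]
    [MeasurableSpace γ] [MeasurableSpace δ] {G : α → β → γ} (hG : Measurable (Function.uncurry G))
    {f : δ → α} {g : δ → β} (hf : Measurable f) (hg : Measurable g) :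
    Measurable fun p => G (f p) (g p) :=
  hG.comp (hf.prodMk hg)

lemma ae_pos_interarrival :
    ∀ᵐ e ∂(Measure.infinitePi fun _ : ℕ => expMeasure 1), ∀ n, 0 < e n := by
  rw [ae_all_iff]
  intro n
  exact (measurePreserving_eval_infinitePi (fun _ : ℕ => expMeasure 1) n).quasiMeasurePreserving.ae
    ae_expMeasure_one_pos

lemma strictMono_partialSums {e : ℕ → ℝ} (he : ∀ n, 0 < e n) :
    StrictMono fun n => ∑ i ∈ Finset.range n, e i :=
  strictMono_nat_of_lt_succ fun n => by simpa [Finset.sum_range_succ] using he n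

lemma tsum_setLIntegral_Ioc_partialSums {e : ℕ → ℝ} (he : ∀ n, 0 < e n) (f : ℝ → ℝ≥0∞) :
    ∑' j, ∫⁻ s in Set.Ioc (∑ i ∈ Finset.range j, e i) (arrivalTimes e j), f s
      = ∫⁻ s in ⋃ j, Set.Ioc (∑ i ∈ Finset.range j, e i) (arrivalTimes e j), f s := by
  rw [lintegral_iUnion (fun _ => measurableSet_Ioc)]
  exact (strictMono_partialSums he).monotone.pairwise_disjoint_on_Ioc_succ

/-- The gaps are disjoint, so the sum over `j` becomes one integral over their union. The union is
left as it is: that it exhausts the half-line is derived from this very formula in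
`ae_tendsto_arrivalTimes`. -/
lemma tsum_lintegral_arrivalLaw_removeAt_eq {F : ℝ → (ℕ → ℝ) → ℝ≥0∞}
    (hF : Measurable (Function.uncurry F)) :
    ∑' j, ∫⁻ t, F (t j) (removeAt j t) ∂arrivalLaw
      = ∫⁻ e : ℕ → ℝ, (∫⁻ s in ⋃ j, Set.Ioc (∑ i ∈ Finset.range j, e i) (arrivalTimes e j),
          F s (arrivalTimes e)) ∂(Measure.infinitePi fun _ : ℕ => expMeasure 1) := by
  simp_rw [lintegral_arrivalLaw_removeAt _ hF]
  rw [← lintegral_tsum]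
  · refine lintegral_congr_ae ?_
    filter_upwards [ae_pos_interarrival] with e he
    exact tsum_setLIntegral_Ioc_partialSums he _
  · intro j
    refine Measurable.aemeasurable ?_
    simp_rw [← lintegral_indicator measurableSet_Ioc]
    refine Measurable.lintegral_prod_right'
      (f := fun p : (ℕ → ℝ) × ℝ => (Set.Ioc (∑ i ∈ Finset.range j, p.1 i)
        (arrivalTimes p.1 j)).indicator (fun s => F s (arrivalTimes p.1)) p.2) ?_
    simp only [Set.indicator_apply, Set.mem_Ioc]
    refine Measurable.ite ?_ (measurable_uncurry_comp hF measurable_snd (by fun_prop))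
      measurable_const
    exact (measurableSet_lt (by fun_prop) measurable_snd).inter
      (measurableSet_le measurable_snd (by fun_prop))

lemma lintegral_exp_neg_Ioi : ∫⁻ x in Set.Ioi (0 : ℝ), ENNReal.ofReal (Real.exp (-x)) = 1 := by
  have := lintegral_expMeasure_one (F := fun _ => 1) measurable_const
  simpa using this.symm

/-- The arrival times of a Poisson process tend to infinity. -/
lemma ae_tendsto_arrivalTimes :
    ∀ᵐ e ∂(Measure.infinitePi fun _ : ℕ => expMeasure 1),
      Tendsto (arrivalTimes e) atTop atTop := by
  -- With the test function e⁻ˢ the formula bounds the mean of Σ exp(-Tⱼ) by ∫₀^∞ e⁻ˢ ds = 1. The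
  -- series is then almost surely finite, its terms tend to zero, and the arrivals diverge.
  have hsum := tsum_lintegral_arrivalLaw_removeAt_eq
    (F := fun s _ => ENNReal.ofReal (Real.exp (-s))) (by fun_prop)
  have hle : ∫⁻ e, ∑' j, ENNReal.ofReal (Real.exp (-(arrivalTimes e j)))
      ∂(Measure.infinitePi fun _ : ℕ => expMeasure 1) ≤ 1 := by
    rw [lintegral_tsum fun j => by fun_prop]
    have : ∀ j, ∫⁻ t, ENNReal.ofReal (Real.exp (-(t j))) ∂arrivalLaw
        = ∫⁻ e, ENNReal.ofReal (Real.exp (-(arrivalTimes e j)))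
            ∂(Measure.infinitePi fun _ : ℕ => expMeasure 1) := fun j => by
      rw [arrivalLaw, lintegral_map (by fun_prop) measurable_arrivalTimes]
    simp_rw [← this, hsum]
    calc _ ≤ ∫⁻ e : ℕ → ℝ, 1 ∂(Measure.infinitePi fun _ : ℕ => expMeasure 1) := by
          refine lintegral_mono_ae ?_
          filter_upwards [ae_pos_interarrival] with e he
          rw [← lintegral_exp_neg_Ioi]
          refine lintegral_mono_set (Set.iUnion_subset fun j s hs => ?_)
          exact lt_of_le_of_lt (Finset.sum_nonneg fun i _ => (he i).le) hs.1
      _ = 1 := by simp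
  filter_upwards [ae_pos_interarrival,
    ae_lt_top (by fun_prop) (hle.trans_lt ENNReal.one_lt_top).ne] with e he hfin
  have h0 := ENNReal.tendsto_atTop_zero_of_tsum_ne_top hfin.ne
  have h1 : Tendsto (fun j => Real.exp (-(arrivalTimes e j))) atTop (𝓝 0) := by
    have := (ENNReal.tendsto_toReal ENNReal.zero_ne_top).comp h0
    simpa [Function.comp_def, ENNReal.toReal_ofReal (Real.exp_nonneg _)] using this
  simpa using tendsto_neg_atBot_iff.1 (Real.tendsto_exp_comp_nhds_zero.1 h1)

lemma iUnion_Ioc_partialSums {e : ℕ → ℝ} (he : ∀ n, 0 < e n)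
    (htop : Tendsto (arrivalTimes e) atTop atTop) :
    ⋃ j, Set.Ioc (∑ i ∈ Finset.range j, e i) (arrivalTimes e j) = Set.Ioi 0 := by
  have h : ¬ BddAbove (Set.range fun n => ∑ i ∈ Finset.range n, e i) :=
    not_bddAbove_of_tendsto_atTop ((tendsto_add_atTop_iff_nat 1).1 htop)
  have := iUnion_Ioc_map_succ_eq_Ioi
    (fun n => (strictMono_partialSums he).monotone bot_le) h
  simpa [arrivalTimes] using this

lemma tsum_lintegral_arrivalLaw_removeAt {F : ℝ → (ℕ → ℝ) → ℝ≥0∞}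
    (hF : Measurable (Function.uncurry F)) :
    ∑' j, ∫⁻ t, F (t j) (removeAt j t) ∂arrivalLaw
      = ∫⁻ t, (∫⁻ s in Set.Ioi 0, F s t) ∂arrivalLaw := by
  rw [tsum_lintegral_arrivalLaw_removeAt_eq hF, arrivalLaw, lintegral_map _ measurable_arrivalTimes]
  · refine lintegral_congr_ae ?_
    filter_upwards [ae_pos_interarrival, ae_tendsto_arrivalTimes] with e he htop
    rw [iUnion_Ioc_partialSums he htop]
  · exact Measurable.lintegral_prod_left' hF

lemma ae_arrivalLaw_strictMono : ∀ᵐ t ∂arrivalLaw, 0 < t 0 ∧ StrictMono t := by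
  rw [arrivalLaw, ae_map_iff measurable_arrivalTimes.aemeasurable]
  · filter_upwards [ae_pos_interarrival] with e he
    exact ⟨by simpa [arrivalTimes] using he 0,
      (strictMono_partialSums he).comp (strictMono_id.add_const 1)⟩
  · refine (measurableSet_lt measurable_const (measurable_pi_apply 0)).inter ?_
    have : {t : ℕ → ℝ | StrictMono t} = ⋂ n, {t | t n < t (n + 1)} := by
      ext t
      simpa using ⟨fun h n => h n.lt_succ_self, strictMono_nat_of_lt_succ⟩
    change MeasurableSet {t : ℕ → ℝ | StrictMono t}
    rw [this]
    exact MeasurableSet.iInter fun n =>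
      measurableSet_lt (measurable_pi_apply _) (measurable_pi_apply _)

variable {𝒵 : Type*} [MeasurableSpace 𝒵]

/-- The joint law of the arrival times of a Poisson process with rate `1` and of an independent
i.i.d. sequence of marks with distribution `Q`. -/
noncomputable def markedLaw (Q : Measure 𝒵) : Measure ((ℕ → ℝ) × (ℕ → 𝒵)) :=
  arrivalLaw.prod (Measure.infinitePi fun _ : ℕ => Q)

instance (Q : Measure 𝒵) [IsProbabilityMeasure Q] : IsProbabilityMeasure (markedLaw Q) := by
  unfold markedLaw
  infer_instance

/-- Mecke's formula for a marked Poisson process, in terms of its ordered points. -/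
lemma tsum_lintegral_markedLaw_removeAt (Q : Measure 𝒵) [IsProbabilityMeasure Q]
    {G : (ℝ × 𝒵) → ((ℕ → ℝ) × (ℕ → 𝒵)) → ℝ≥0∞} (hG : Measurable (Function.uncurry G)) :
    ∑' j, ∫⁻ x, G (x.1 j, x.2 j) (removeAt j x.1, removeAt j x.2) ∂(markedLaw Q)
      = ∫⁻ s in Set.Ioi 0, ∫⁻ z, ∫⁻ x, G (s, z) x ∂(markedLaw Q) ∂Q := by
  set F : ℝ → (ℕ → ℝ) → ℝ≥0∞ := fun s t =>
    ∫⁻ ζ, ∫⁻ z, G (s, ζ) (t, z) ∂(Measure.infinitePi fun _ : ℕ => Q) ∂Q with hFdef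
  have hF : Measurable (Function.uncurry F) := by
    refine Measurable.lintegral_prod_right' (f := fun p : (ℝ × (ℕ → ℝ)) × 𝒵 =>
      ∫⁻ z, G (p.1.1, p.2) (p.1.2, z) ∂(Measure.infinitePi fun _ : ℕ => Q)) ?_
    refine Measurable.lintegral_prod_right' (f := fun p : ((ℝ × (ℕ → ℝ)) × 𝒵) × (ℕ → 𝒵) =>
      G (p.1.1.1, p.1.2) (p.1.1.2, p.2)) ?_
    exact measurable_uncurry_comp hG (by fun_prop) (by fun_prop)
  have h1 : ∀ j, ∫⁻ x, G (x.1 j, x.2 j) (removeAt j x.1, removeAt j x.2) ∂(markedLaw Q)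
      = ∫⁻ t, F (t j) (removeAt j t) ∂arrivalLaw := by
    intro j
    have hmj : Measurable fun x : (ℕ → ℝ) × (ℕ → 𝒵) =>
      G (x.1 j, x.2 j) (removeAt j x.1, removeAt j x.2) := measurable_uncurry_comp hG (by fun_prop) (by fun_prop)
    rw [markedLaw, lintegral_prod _ hmj.aemeasurable]
    refine lintegral_congr fun t => ?_
    rw [lintegral_infinitePi_insertAt Q j (F := fun z =>
      G (t j, z j) (removeAt j t, removeAt j z)) (hmj.comp measurable_prodMk_left)]
    simp [hFdef]
  simp_rw [h1]
  rw [tsum_lintegral_arrivalLaw_removeAt hF,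
    lintegral_lintegral_swap (f := fun t s => F s t) (hF.comp measurable_swap).aemeasurable]
  refine lintegral_congr fun s => ?_
  have hFs : Measurable fun p : (ℕ → ℝ) × 𝒵 =>
      ∫⁻ z, G (s, p.2) (p.1, z) ∂(Measure.infinitePi fun _ : ℕ => Q) := by
    refine Measurable.lintegral_prod_right' (f := fun p : ((ℕ → ℝ) × 𝒵) × (ℕ → 𝒵) =>
      G (s, p.1.2) (p.1.1, p.2)) ?_
    exact measurable_uncurry_comp hG (by fun_prop) (by fun_prop)
  simp only [hFdef]
  rw [lintegral_lintegral_swap hFs.aemeasurable]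
  refine lintegral_congr fun ζ => ?_
  rw [markedLaw, lintegral_prod (fun x => G (s, ζ) x)
    (measurable_uncurry_comp hG measurable_const measurable_id).aemeasurable]

end Mecke

/-! ### Laplace functionals of the rescaled process. -/

section Laplace

open Filter Topology

/-- The function `x ↦ e⁻ˣ` on `[0, ∞]`. -/
noncomputable def expNeg (x : ℝ≥0∞) : ℝ≥0∞ :=
  if x = ∞ then 0 else ENNReal.ofReal (Real.exp (-x.toReal))

@[simp] lemma expNeg_zero : expNeg 0 = 1 := by simp [expNeg]

@[simp] lemma expNeg_top : expNeg ∞ = 0 := by simp [expNeg]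

lemma expNeg_ofReal {x : ℝ} (hx : 0 ≤ x) :
    expNeg (ENNReal.ofReal x) = ENNReal.ofReal (Real.exp (-x)) := by
  simp [expNeg, hx]

lemma expNeg_add (x y : ℝ≥0∞) : expNeg (x + y) = expNeg x * expNeg y := by
  by_cases hx : x = ∞
  · simp [hx]
  by_cases hy : y = ∞
  · simp [hy]
  rw [expNeg, expNeg, expNeg, if_neg hx, if_neg hy, if_neg (by simp [hx, hy]),
    ENNReal.toReal_add hx hy, neg_add, Real.exp_add, ENNReal.ofReal_mul (Real.exp_nonneg _)]

lemma expNeg_antitone : Antitone expNeg := by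
  intro x y hxy
  by_cases hy : y = ∞
  · simp [hy]
  have hx : x ≠ ∞ := ne_top_of_le_ne_top hy hxy
  rw [expNeg, expNeg, if_neg hx, if_neg hy]
  exact ENNReal.ofReal_le_ofReal (Real.exp_le_exp.2 (neg_le_neg (ENNReal.toReal_mono hy hxy)))

lemma expNeg_le_one (x : ℝ≥0∞) : expNeg x ≤ 1 := by
  simpa using expNeg_antitone (zero_le (a := x))

@[fun_prop]
lemma measurable_expNeg : Measurable expNeg :=
  expNeg_antitone.measurable

/-- Telescoping: the terms of `b` are replaced by those of `a` one at a time. The swap at `k`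
multiplies `expNeg (a k) - expNeg (b k)` by `expNeg` of a mixed sum without index `k`, and that
mixed sum is at most the sum of `b` without index `k`. -/
lemma expNeg_tsum_add_tsum_le {a b : ℕ → ℝ≥0∞} (hab : ∀ n, a n ≤ b n) :
    expNeg (∑' n, b n)
        + ∑' k, (expNeg (a k) - expNeg (b k)) * expNeg (∑' n, removeAt k b n)
      ≤ expNeg (∑' n, a n) := by
  have key : ∀ N, expNeg (∑' n, b n) + ∑ k ∈ Finset.range N,
      (expNeg (a k) - expNeg (b k)) * expNeg (∑' n, removeAt k b n)
      ≤ expNeg ((∑ n ∈ Finset.range N, a n) + ∑' n, b (n + N)) := by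
    intro N
    induction N with
    | zero => simp
    | succ N ih =>
      have hsplit : ∑' n, b (n + N) = b N + ∑' n, b (n + (N + 1)) := by
        rw [tsum_eq_zero_add' ENNReal.summable]
        simp [add_assoc, add_comm 1 N]
      have hrem : (∑ n ∈ Finset.range N, a n) + ∑' n, b (n + (N + 1))
          ≤ ∑' n, removeAt N b n := by
        rw [← ENNReal.summable.sum_add_tsum_nat_add' (k := N) (f := removeAt N b)]
        refine add_le_add (Finset.sum_le_sum fun n hn => ?_) (le_of_eq ?_)
        · simpa [removeAt, skipIndex, Finset.mem_range.1 hn] using hab n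
        · simp [removeAt, skipIndex, add_assoc]
      rw [Finset.sum_range_succ, ← add_assoc]
      calc _ ≤ expNeg ((∑ n ∈ Finset.range N, a n) + ∑' n, b (n + N))
            + (expNeg (a N) - expNeg (b N))
              * expNeg ((∑ n ∈ Finset.range N, a n) + ∑' n, b (n + (N + 1))) := by
            gcongr
            exact expNeg_antitone hrem
        _ = (expNeg (b N) + (expNeg (a N) - expNeg (b N)))
              * expNeg ((∑ n ∈ Finset.range N, a n) + ∑' n, b (n + (N + 1))) := by
            rw [hsplit, add_left_comm, expNeg_add, add_mul]
        _ = _ := by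
            rw [add_tsub_cancel_of_le (expNeg_antitone (hab N)), ← expNeg_add,
              Finset.sum_range_succ]
            congr 1
            ring
  rw [ENNReal.tsum_eq_iSup_nat (f := fun k => (expNeg (a k) - expNeg (b k)) * _),
    ENNReal.add_iSup]
  refine iSup_le fun N => (key N).trans (expNeg_antitone ?_)
  rw [← ENNReal.summable.sum_add_tsum_nat_add' (k := N) (f := a)]
  gcongr with n
  exact hab _

variable {𝒵 : Type*}

/-- The arrival times rescaled by the inverse of the density `r` at the marks. -/
noncomputable def scaledTimes (r : 𝒵 → ℝ≥0∞) (x : (ℕ → ℝ) × (ℕ → 𝒵)) (n : ℕ) : ℝ≥0∞ :=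
  ENNReal.ofReal (x.1 n) / r (x.2 n)

lemma removeAt_scaledTimes (r : 𝒵 → ℝ≥0∞) (x : (ℕ → ℝ) × (ℕ → 𝒵)) (j : ℕ) :
    removeAt j (scaledTimes r x) = scaledTimes r (removeAt j x.1, removeAt j x.2) := rfl

variable [MeasurableSpace 𝒵]

@[fun_prop]
lemma measurable_scaledTimes {r : 𝒵 → ℝ≥0∞} (hr : Measurable r) :
    Measurable (scaledTimes r) := by
  unfold scaledTimes
  fun_prop

lemma setLIntegral_Ioi_comp_mul {f : ℝ → ℝ≥0∞} (hf : Measurable f) {a : ℝ} (ha : 0 < a) :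
    ∫⁻ s in Set.Ioi 0, f s = ENNReal.ofReal a * ∫⁻ t in Set.Ioi 0, f (a * t) := by
  rw [← lintegral_indicator measurableSet_Ioi, ← lintegral_indicator measurableSet_Ioi]
  conv_lhs => rw [← Real.smul_map_volume_mul_left ha.ne']
  rw [lintegral_smul_measure, lintegral_map (hf.indicator measurableSet_Ioi)
    (measurable_const_mul a), abs_of_pos ha, smul_eq_mul]
  congr 1
  refine lintegral_congr fun t => ?_
  simp [Set.indicator_apply, ha]

/-- Rescaling the time by a density `r` turns the intensity measure `ds Q(dz)` into
`dt r(z) Q(dz)`. -/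
lemma lintegral_scaledTime (Q : Measure 𝒵) [IsProbabilityMeasure Q] {r : 𝒵 → ℝ≥0∞}
    (hr : Measurable r) (hr_top : ∀ᵐ z ∂Q, r z ≠ ∞) {F : ℝ≥0∞ → 𝒵 → ℝ≥0∞}
    (hF : Measurable (Function.uncurry F)) (hF_top : ∀ z, F ∞ z = 0) :
    ∫⁻ s in Set.Ioi 0, ∫⁻ z, F (ENNReal.ofReal s / r z) z ∂Q
      = ∫⁻ z, r z * (∫⁻ t in Set.Ioi 0, F (ENNReal.ofReal t) z) ∂Q := by
  have hm : Measurable fun p : ℝ × 𝒵 => F (ENNReal.ofReal p.1 / r p.2) p.2 :=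
    measurable_uncurry_comp hF (by fun_prop) (by fun_prop)
  rw [lintegral_lintegral_swap (f := fun s z => F (ENNReal.ofReal s / r z) z) hm.aemeasurable]
  refine lintegral_congr_ae ?_
  filter_upwards [hr_top] with z hz
  -- A mark of density zero has rescaled time ∞, where `F` vanishes; this matches the factor `r z =
  -- 0` on the right.
  by_cases h0 : r z = 0
  · rw [h0, zero_mul, setLIntegral_congr_fun (g := fun _ => 0) measurableSet_Ioi]
    · simp
    · intro s hs
      simp only
      rw [ENNReal.div_zero (by simpa using hs), hF_top]
  · have hpos : 0 < (r z).toReal := ENNReal.toReal_pos h0 hz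
    rw [setLIntegral_Ioi_comp_mul (f := fun s => F (ENNReal.ofReal s / r z) z)
      (hm.comp measurable_prodMk_right) hpos, ENNReal.ofReal_toReal hz]
    congr 1
    refine lintegral_congr fun t => ?_
    rw [ENNReal.ofReal_mul hpos.le, ENNReal.ofReal_toReal hz, mul_comm,
      ENNReal.mul_div_cancel_right h0 hz]

/-- One step of the computation of the Laplace functional of the rescaled process. -/
lemma lintegral_expNeg_tsum_mul_le (Q : Measure 𝒵) [IsProbabilityMeasure Q] {r : 𝒵 → ℝ≥0∞}
    (hr : Measurable r) (hr_int : ∫⁻ z, r z ∂Q = 1) {φ ψ : ℝ≥0∞ → ℝ≥0∞} (hφ : Measurable φ)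
    (hψ : Measurable ψ) (hφψ : ∀ x, φ x ≤ ψ x) (hψ_top : ψ ∞ = 0) :
    (∫⁻ x, expNeg (∑' n, ψ (scaledTimes r x n)) ∂(markedLaw Q))
        * (1 + ∫⁻ t in Set.Ioi 0,
            (expNeg (φ (ENNReal.ofReal t)) - expNeg (ψ (ENNReal.ofReal t))))
      ≤ ∫⁻ x, expNeg (∑' n, φ (scaledTimes r x n)) ∂(markedLaw Q) := by
  have hr_top : ∀ᵐ z ∂Q, r z ≠ ∞ := by
    filter_upwards [ae_lt_top hr (by simp [hr_int])] with z hz using hz.ne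
  set E := ∫⁻ x, expNeg (∑' n, ψ (scaledTimes r x n)) ∂(markedLaw Q)
  -- The integrand is the summand of `expNeg_tsum_add_tsum_le`, with the point `j` singled out from
  -- the rest of the configuration.
  have hmecke := tsum_lintegral_markedLaw_removeAt Q
    (G := fun p x => (expNeg (φ (ENNReal.ofReal p.1 / r p.2))
      - expNeg (ψ (ENNReal.ofReal p.1 / r p.2))) * expNeg (∑' n, ψ (scaledTimes r x n)))
    (by
      refine Measurable.mul (Measurable.sub ?_ ?_) ?_
      · fun_prop
      · fun_prop
      · refine measurable_expNeg.comp (Measurable.tsum fun n => hψ.comp ?_)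
        exact (measurable_pi_apply n).comp ((measurable_scaledTimes hr).comp measurable_snd))
  have hconst : ∀ (s : ℝ) (z : 𝒵), ∫⁻ x, (expNeg (φ (ENNReal.ofReal s / r z))
      - expNeg (ψ (ENNReal.ofReal s / r z))) * expNeg (∑' n, ψ (scaledTimes r x n))
        ∂(markedLaw Q) = (expNeg (φ (ENNReal.ofReal s / r z))
      - expNeg (ψ (ENNReal.ofReal s / r z))) * E := fun s z =>
    lintegral_const_mul' _ _ (ne_top_of_le_ne_top ENNReal.one_ne_top
      (tsub_le_self.trans (expNeg_le_one _)))
  have hE : E ≠ ∞ := by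
    refine ne_top_of_le_ne_top ENNReal.one_ne_top ?_
    calc E ≤ ∫⁻ _, 1 ∂(markedLaw Q) := lintegral_mono fun _ => expNeg_le_one _
      _ = 1 := by simp
  simp only [hconst] at hmecke
  simp_rw [lintegral_mul_const' _ _ hE] at hmecke
  -- In rescaled time the integrand ignores the mark, so only the total mass 1 of `r` enters.
  rw [lintegral_scaledTime Q hr hr_top (F := fun y _ => expNeg (φ y) - expNeg (ψ y))
    (by fun_prop) (by
      intro z
      have : φ ∞ = 0 := le_zero_iff.1 (hψ_top ▸ hφψ ∞)
      simp [this, hψ_top]), lintegral_mul_const _ hr, hr_int, one_mul] at hmecke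
  have hm : Measurable fun x => expNeg (∑' n, ψ (scaledTimes r x n)) :=
    measurable_expNeg.comp (Measurable.tsum fun n => hψ.comp
      ((measurable_pi_apply n).comp (measurable_scaledTimes hr)))
  rw [mul_add, mul_one, mul_comm E, ← hmecke, ← lintegral_tsum, ← lintegral_add_left hm]
  · exact lintegral_mono fun x => expNeg_tsum_add_tsum_le fun n => hφψ _
  · intro j
    refine Measurable.aemeasurable (Measurable.mul (Measurable.sub ?_ ?_) ?_)
    · fun_prop
    · fun_prop
    · refine measurable_expNeg.comp (Measurable.tsum fun n => hψ.comp ?_)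
      exact (measurable_pi_apply n).comp ((measurable_scaledTimes hr).comp (by fun_prop))

/-- A discrete Grönwall inequality. -/
lemma le_exp_neg_of_mul_one_add_le {G : ℝ → ℝ≥0∞} {b : ℝ} (hb : 0 < b)
    (hG : ∀ a, 0 < a → a ≤ b → G a ≤ 1)
    (hstep : ∀ a a', 0 < a → a ≤ a' → a' ≤ b → G a' * (1 + ENNReal.ofReal (a' - a)) ≤ G a) :
    G b ≤ ENNReal.ofReal (Real.exp (-b)) := by
  -- `N` steps of length b/(N+1) descend from `b` to b/(N+1) and stop there, since the hypotheses
  -- concern positive arguments only.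
  have key : ∀ N : ℕ, G b * ENNReal.ofReal ((1 + b / (N + 1)) ^ N) ≤ 1 := by
    intro N
    have hN : (0 : ℝ) < N + 1 := by positivity
    have hδ : 0 < b / (N + 1) := by positivity
    have : ∀ k : ℕ, k ≤ N →
        G b * ENNReal.ofReal ((1 + b / (N + 1)) ^ k) ≤ G (b - k * (b / (N + 1))) := by
      intro k hk
      induction k with
      | zero => simp
      | succ k ih =>
        have hk' : ((k : ℝ) + 1) ≤ N := by exact_mod_cast hk
        have hbN : b = (N + 1) * (b / (N + 1)) := by field_simp
        have h1 := hstep (b - (k + 1 : ℕ) * (b / (N + 1))) (b - k * (b / (N + 1)))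
          (by push_cast; nlinarith) (by push_cast; nlinarith)
          (by nlinarith [mul_nonneg k.cast_nonneg hδ.le])
        refine le_trans (le_of_eq ?_) ((mul_le_mul_left (ih (by omega)) _).trans h1)
        rw [mul_assoc, pow_succ, ENNReal.ofReal_mul (by positivity)]
        congr 2
        rw [← ENNReal.ofReal_one, ← ENNReal.ofReal_add zero_le_one (by push_cast; nlinarith)]
        congr 1
        push_cast
        ring
    refine (this N le_rfl).trans (hG _ ?_ ?_)
    · have hbN : b = (N + 1) * (b / (N + 1)) := by field_simp
      nlinarith
    · nlinarith [mul_nonneg N.cast_nonneg hδ.le]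
  have hlim : Tendsto (fun N : ℕ => (1 + b / (N + 1)) ^ N) atTop (𝓝 (Real.exp b)) := by
    have h1 := (tendsto_add_atTop_iff_nat 1).2 (Real.tendsto_one_add_div_pow_exp b)
    have h2 : Tendsto (fun N : ℕ => 1 + b / ((N : ℝ) + 1)) atTop (𝓝 1) := by
      simpa using ((tendsto_add_atTop_iff_nat 1).2
        (tendsto_const_div_atTop_nhds_zero_nat b)).const_add 1
    have h3 := h1.div h2 one_ne_zero
    simp only [div_one] at h3
    refine h3.congr fun N => ?_
    have : (1 + b / ((N : ℝ) + 1)) ≠ 0 := by positivity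
    simp only [Pi.div_apply]
    push_cast
    rw [pow_succ]
    field_simp
  have h1 : G b * ENNReal.ofReal (Real.exp b) ≤ 1 :=
    le_of_tendsto' (ENNReal.Tendsto.const_mul (ENNReal.tendsto_ofReal hlim)
      (Or.inl (by simp [Real.exp_pos]))) key
  rw [Real.exp_neg, ENNReal.ofReal_inv_of_pos (Real.exp_pos b)]
  exact ENNReal.le_inv_iff_mul_le.2 h1

end Laplace

/-! ### Selection rules and the Laplace bounds they require. -/

section SelectionRules

open Filter Topology

/-- A rule that selects a point at the rescaled time `a` with probability `Ψ a σ` when the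
rescaled times of the other points are `σ₀, σ₁, …`. -/
structure IsSelectionRule (Ψ : ℝ≥0∞ → (ℕ → ℝ≥0∞) → ℝ≥0∞) : Prop where
  measurable : Measurable (Function.uncurry Ψ)
  le_removeAt : ∀ a σ j, Ψ a σ ≤ Ψ a (removeAt j σ)
  top : ∀ σ, Ψ ∞ σ = 0

/-- The selection rule with weights `a ^ (-α)`. -/
noncomputable def powerRule (α : ℝ) (a : ℝ≥0∞) (σ : ℕ → ℝ≥0∞) : ℝ≥0∞ :=
  a ^ (-α) / (a ^ (-α) + ∑' n, σ n ^ (-α))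

open Classical in
/-- The selection rule that selects the minimal rescaled time. -/
noncomputable def argminRule (a : ℝ≥0∞) (σ : ℕ → ℝ≥0∞) : ℝ≥0∞ :=
  if a ≠ ∞ ∧ ∀ n, a ≤ σ n then 1 else 0

lemma isSelectionRule_powerRule {α : ℝ} (hα : 0 < α) : IsSelectionRule (powerRule α) where
  measurable := by
    have h : Measurable fun p : ℝ≥0∞ × (ℕ → ℝ≥0∞) => ∑' n, p.2 n ^ (-α) :=
      Measurable.tsum fun n => by fun_prop
    exact Measurable.div (by fun_prop) (.add (by fun_prop) h)
  le_removeAt a σ j := by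
    refine ENNReal.div_le_div_left (add_le_add le_rfl ?_) _
    rw [tsum_eq_add_tsum_removeAt (fun n => σ n ^ (-α)) j]
    exact le_add_self
  top σ := by simp [powerRule, ENNReal.top_rpow_of_neg (neg_neg_of_pos hα)]

lemma isSelectionRule_argminRule : IsSelectionRule argminRule where
  measurable := by
    refine Measurable.ite ?_ measurable_const measurable_const
    simp only [Set.ofPred_and, Set.ofPred_forall]
    refine MeasurableSet.inter (measurableSet_eq_fun measurable_fst measurable_const).compl ?_
    exact MeasurableSet.iInter fun n => measurableSet_le measurable_fst (by fun_prop)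
  le_removeAt a σ j := by
    simp only [argminRule]
    split_ifs with h1 h2
    · exact le_rfl
    · exact absurd ⟨h1.1, fun n => h1.2 _⟩ h2
    · exact zero_le_one
    · exact le_rfl
  top σ := by simp [argminRule]

lemma lintegral_Gamma {s : ℝ} (hs : 0 < s) :
    ∫⁻ u in Set.Ioi 0, ENNReal.ofReal (Real.exp (-u) * u ^ (s - 1))
      = ENNReal.ofReal (Real.Gamma s) := by
  rw [Real.Gamma_eq_integral hs, ofReal_integral_eq_lintegral_ofReal
    (Real.GammaIntegral_convergent hs)]
  filter_upwards [ae_restrict_mem measurableSet_Ioi] with u hu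
  have : (0 : ℝ) < u := hu
  positivity

lemma lintegral_rpow_mul_exp_neg_mul {s k : ℝ} (hs : 0 < s) (hk : 0 < k) :
    ∫⁻ u in Set.Ioi 0, ENNReal.ofReal (u ^ (s - 1) * Real.exp (-(k * u)))
      = ENNReal.ofReal (Real.Gamma s / k ^ s) := by
  rw [setLIntegral_Ioi_comp_mul (by fun_prop) (inv_pos.2 hk),
    ← lintegral_const_mul' _ _ ENNReal.ofReal_ne_top]
  have : Real.Gamma s / k ^ s = (k ^ s)⁻¹ * Real.Gamma s := by ring
  rw [this, ENNReal.ofReal_mul (by positivity), ← lintegral_Gamma hs,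
    ← lintegral_const_mul' _ _ ENNReal.ofReal_ne_top]
  refine setLIntegral_congr_fun measurableSet_Ioi fun u hu => ?_
  have hu : 0 < u := hu
  rw [← ENNReal.ofReal_mul (by positivity), ← ENNReal.ofReal_mul (by positivity)]
  congr 1
  rw [Real.mul_rpow (by positivity) hu.le, mul_inv_cancel_left₀ hk.ne', Real.inv_rpow hk.le,
    Real.rpow_sub_one hk.ne']
  field_simp

lemma setLIntegral_Ioc_exp_neg {p q : ℝ} (h : p ≤ q) :
    ∫⁻ u in Set.Ioc p q, ENNReal.ofReal (Real.exp (-u))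
      = ENNReal.ofReal (Real.exp (-p)) - ENNReal.ofReal (Real.exp (-q)) := by
  rw [← ENNReal.ofReal_sub _ (Real.exp_nonneg _), ← ofReal_integral_eq_lintegral_ofReal,
    ← intervalIntegral.integral_of_le h]
  · congr 1
    rw [intervalIntegral.integral_comp_neg, integral_exp]
  · exact (Continuous.integrableOn_Icc (by fun_prop)).mono_set Set.Ioc_subset_Icc_self
  · exact Eventually.of_forall fun u => Real.exp_nonneg _

/-- The difference is the integral of e⁻ᵘ over an interval of `u` depending on `t`. After exchanging
the integrals, the admissible `t` for fixed `u` fill an interval of length (x^(1/α) - y^(1/α))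
u^(-1/α), and a Gamma integral remains. -/
lemma lintegral_expNeg_sub_expNeg_rpow {α x y : ℝ} (hα : 1 < α) (hy : 0 < y) (hyx : y ≤ x) :
    ∫⁻ t in Set.Ioi 0, (expNeg (ENNReal.ofReal y * ENNReal.ofReal t ^ (-α))
        - expNeg (ENNReal.ofReal x * ENNReal.ofReal t ^ (-α)))
      = ENNReal.ofReal (Real.Gamma (1 - α⁻¹) * (x ^ α⁻¹ - y ^ α⁻¹)) := by
  have hα0 : 0 < α := one_pos.trans hα
  have hx : 0 < x := hy.trans_le hyx
  set D : ℝ → ℝ → ℝ≥0∞ := fun t u =>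
    if y * t ^ (-α) < u ∧ u ≤ x * t ^ (-α) then ENNReal.ofReal (Real.exp (-u)) else 0 with hD
  have hDm : Measurable (Function.uncurry D) := by
    refine Measurable.ite ?_ (by fun_prop) measurable_const
    exact (measurableSet_lt (by fun_prop) measurable_snd).inter
      (measurableSet_le measurable_snd (by fun_prop))
  have h1 : ∫⁻ t in Set.Ioi 0, (expNeg (ENNReal.ofReal y * ENNReal.ofReal t ^ (-α))
        - expNeg (ENNReal.ofReal x * ENNReal.ofReal t ^ (-α)))
      = ∫⁻ t in Set.Ioi 0, ∫⁻ u in Set.Ioi 0, D t u := by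
    refine setLIntegral_congr_fun measurableSet_Ioi fun t ht => ?_
    have ht : 0 < t := ht
    have htα : 0 < t ^ (-α) := Real.rpow_pos_of_pos ht _
    rw [ENNReal.ofReal_rpow_of_pos ht, ← ENNReal.ofReal_mul hy.le, ← ENNReal.ofReal_mul hx.le,
      expNeg_ofReal (by positivity), expNeg_ofReal (by positivity),
      ← setLIntegral_Ioc_exp_neg (by gcongr), ← lintegral_indicator measurableSet_Ioc,
      ← lintegral_indicator measurableSet_Ioi]
    refine lintegral_congr fun u => ?_
    by_cases hu : 0 < u
    · simp [hD, Set.indicator_apply, hu]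
    · have : ¬ (y * t ^ (-α) < u) := fun h => hu ((by positivity : 0 < y * t ^ (-α)).trans h)
      simp [hD, hu, this]
  have h2 : ∀ u ∈ Set.Ioi (0 : ℝ), ∫⁻ t in Set.Ioi 0, D t u
      = ENNReal.ofReal (x ^ α⁻¹ - y ^ α⁻¹)
        * ENNReal.ofReal (Real.exp (-u) * u ^ ((1 - α⁻¹) - 1)) := by
    intro u hu
    have hu : 0 < u := hu
    have h3 : ∀ t ∈ Set.Ioi (0 : ℝ), D t u
        = (Set.Ioc ((y / u) ^ α⁻¹) ((x / u) ^ α⁻¹)).indicator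
          (fun _ => ENNReal.ofReal (Real.exp (-u))) t := by
      intro t ht
      have ht : 0 < t := ht
      have e1 : y * t ^ (-α) < u ↔ (y / u) ^ α⁻¹ < t := by
        rw [Real.rpow_inv_lt_iff_of_pos (by positivity) ht.le hα0, div_lt_iff₀ hu,
          Real.rpow_neg ht.le, ← div_eq_mul_inv, div_lt_iff₀ (by positivity), mul_comm]
      have e2 : u ≤ x * t ^ (-α) ↔ t ≤ (x / u) ^ α⁻¹ := by
        rw [Real.le_rpow_inv_iff_of_pos ht.le (by positivity) hα0, le_div_iff₀ hu,
          Real.rpow_neg ht.le, ← div_eq_mul_inv, le_div_iff₀ (by positivity), mul_comm]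
      simp only [hD, Set.indicator_apply, Set.mem_Ioc, e1, e2]
    rw [setLIntegral_congr_fun measurableSet_Ioi h3, lintegral_indicator_const measurableSet_Ioc,
      Measure.restrict_apply measurableSet_Ioc, Set.inter_eq_left.2, Real.volume_Ioc,
      ← ENNReal.ofReal_mul (by positivity), ← ENNReal.ofReal_mul]
    · congr 1
      rw [Real.div_rpow hx.le hu.le, Real.div_rpow hy.le hu.le, sub_sub_cancel_left,
        Real.rpow_neg hu.le]
      ring
    · exact sub_nonneg.2 (Real.rpow_le_rpow hy.le hyx (by positivity))
    · intro t ht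
      exact lt_of_le_of_lt (by positivity) ht.1
  have hα1 : α⁻¹ < 1 := inv_lt_one_of_one_lt₀ hα
  rw [h1, lintegral_lintegral_swap hDm.aemeasurable, setLIntegral_congr_fun measurableSet_Ioi h2,
    lintegral_const_mul' _ _ ENNReal.ofReal_ne_top, lintegral_Gamma (by linarith), mul_comm,
    ← ENNReal.ofReal_mul (Real.Gamma_nonneg_of_nonneg (by linarith))]

variable {𝒵 : Type*} [MeasurableSpace 𝒵]

/-- The sum of the weights of the rescaled points is stochastically at least a stable variable. -/
lemma lintegral_expNeg_tsum_rpow_le (Q : Measure 𝒵) [IsProbabilityMeasure Q] {r : 𝒵 → ℝ≥0∞}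
    (hr : Measurable r) (hr_int : ∫⁻ z, r z ∂Q = 1) {α v : ℝ} (hα : 1 < α) (hv : 0 < v) :
    ∫⁻ x, expNeg (ENNReal.ofReal v * ∑' n, scaledTimes r x n ^ (-α)) ∂(markedLaw Q)
      ≤ ENNReal.ofReal (Real.exp (-(Real.Gamma (1 - α⁻¹) * v ^ α⁻¹))) := by
  have hα0 : 0 < α := one_pos.trans hα
  have hα1 : α⁻¹ < 1 := inv_lt_one_of_one_lt₀ hα
  set c := Real.Gamma (1 - α⁻¹)
  have hc : 0 < c := Real.Gamma_pos_of_pos (by linarith)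
  -- With the coefficient (a/c)^α, the integral from `lintegral_expNeg_sub_expNeg_rpow` between
  -- parameters a ≤ a' is exactly a' - a, as the Grönwall step asks.
  set G : ℝ → ℝ≥0∞ := fun a =>
    ∫⁻ x, expNeg (∑' n, ENNReal.ofReal ((a / c) ^ α) * scaledTimes r x n ^ (-α)) ∂(markedLaw Q)
    with hG
  have hGle : ∀ a, G a ≤ 1 := fun a => by
    calc G a ≤ ∫⁻ _, 1 ∂(markedLaw Q) := lintegral_mono fun _ => expNeg_le_one _
      _ = 1 := by simp
  have hroot : ∀ a, 0 < a → ((a / c) ^ α) ^ α⁻¹ = a / c := fun a ha =>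
    Real.rpow_rpow_inv (by positivity) hα0.ne'
  have hmain := le_exp_neg_of_mul_one_add_le (G := G) (b := c * v ^ α⁻¹) (by positivity)
    (fun a _ _ => hGle a) (by
      intro a a' ha haa' _
      have ha' : 0 < a' := ha.trans_le haa'
      have h1 := lintegral_expNeg_tsum_mul_le Q hr hr_int
        (φ := fun y => ENNReal.ofReal ((a / c) ^ α) * y ^ (-α))
        (ψ := fun y => ENNReal.ofReal ((a' / c) ^ α) * y ^ (-α)) (by fun_prop) (by fun_prop)
        (fun y => by gcongr) (by simp [ENNReal.top_rpow_of_neg (neg_neg_of_pos hα0)])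
      rw [lintegral_expNeg_sub_expNeg_rpow hα (by positivity) (by gcongr), hroot a ha,
        hroot a' ha'] at h1
      convert h1 using 4
      rw [show Real.Gamma (1 - α⁻¹) = c from rfl]
      field_simp)
  convert hmain using 1
  simp only [hG]
  rw [mul_div_cancel_left₀ _ hc.ne', Real.rpow_inv_rpow hv.le hα0.ne']
  simp_rw [ENNReal.tsum_mul_left]

/-- The probability that there is no rescaled point before `T` is at most `e⁻ᵀ`. -/
lemma measure_forall_le_scaledTimes_le (Q : Measure 𝒵) [IsProbabilityMeasure Q] {r : 𝒵 → ℝ≥0∞}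
    (hr : Measurable r) (hr_int : ∫⁻ z, r z ∂Q = 1) {T : ℝ} (hT : 0 < T) :
    markedLaw Q {x | ∀ n, ENNReal.ofReal T ≤ scaledTimes r x n}
      ≤ ENNReal.ofReal (Real.exp (-T)) := by
  classical
  -- The height is chosen so that e^(-ℓ(a)) = 1 - a/T is affine: integrated over (0, T), the
  -- increment is again a' - a.
  set ℓ : ℝ → ℝ≥0∞ := fun a => ENNReal.ofReal (-Real.log (1 - a / T)) with hℓ
  have hexp : ∀ a, 0 < a → a < T → expNeg (ℓ a) = ENNReal.ofReal (1 - a / T) := by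
    intro a ha haT
    have h1 : 0 < 1 - a / T := by rw [sub_pos, div_lt_one hT]; exact haT
    have h2 : 1 - a / T ≤ 1 := by linarith [div_pos ha hT]
    rw [hℓ, expNeg_ofReal (neg_nonneg.2 (Real.log_nonpos h1.le h2)), neg_neg, Real.exp_log h1]
  set φ : ℝ → ℝ≥0∞ → ℝ≥0∞ := fun a y => if y < ENNReal.ofReal T then ℓ a else 0 with hφ
  have hφm : ∀ a, Measurable (φ a) := fun a =>
    Measurable.ite measurableSet_Iio measurable_const measurable_const
  set G : ℝ → ℝ≥0∞ := fun a => ∫⁻ x, expNeg (∑' n, φ a (scaledTimes r x n)) ∂(markedLaw Q)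
  have hGle : ∀ a, G a ≤ 1 := fun a => by
    calc G a ≤ ∫⁻ _, 1 ∂(markedLaw Q) := lintegral_mono fun _ => expNeg_le_one _
      _ = 1 := by simp
  have hbound : ∀ b, 0 < b → b < T → G b ≤ ENNReal.ofReal (Real.exp (-b)) := by
    intro b hb hbT
    refine le_exp_neg_of_mul_one_add_le hb (fun a _ _ => hGle a) ?_
    intro a a' ha haa' ha'b
    have ha' : 0 < a' := ha.trans_le haa'
    have ha'T : a' < T := ha'b.trans_lt hbT
    have hle : a / T ≤ a' / T := by gcongr
    have hpos : 0 < 1 - a' / T := by rw [sub_pos, div_lt_one hT]; exact ha'T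
    have h1 := lintegral_expNeg_tsum_mul_le Q hr hr_int (hφm a) (hφm a')
      (fun y => by
        simp only [hφ]
        split_ifs
        · refine ENNReal.ofReal_le_ofReal (neg_le_neg (Real.log_le_log hpos ?_))
          linarith
        · exact le_rfl) (by simp [hφ])
    convert h1 using 3
    have h2 : ∀ t ∈ Set.Ioi (0 : ℝ), expNeg (φ a (ENNReal.ofReal t))
        - expNeg (φ a' (ENNReal.ofReal t))
        = (Set.Iio T).indicator (fun _ => ENNReal.ofReal ((a' - a) / T)) t := by
      intro t ht
      by_cases htT : t < T
      · have : ENNReal.ofReal t < ENNReal.ofReal T := (ENNReal.ofReal_lt_ofReal_iff hT).2 htT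
        simp only [hφ, this, if_true, Set.indicator_of_mem (Set.mem_Iio.2 htT)]
        rw [hexp a ha (haa'.trans_lt ha'T), hexp a' ha' ha'T, ← ENNReal.ofReal_sub _ hpos.le]
        congr 1
        ring
      · have : ¬ ENNReal.ofReal t < ENNReal.ofReal T := fun h =>
          htT ((ENNReal.ofReal_lt_ofReal_iff hT).1 h)
        simp [hφ, this, Set.indicator_of_notMem (s := Set.Iio T) htT]
    rw [setLIntegral_congr_fun measurableSet_Ioi h2, lintegral_indicator_const measurableSet_Iio,
      Measure.restrict_apply measurableSet_Iio, Set.inter_comm, Set.Ioi_inter_Iio, Real.volume_Ioo,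
      ← ENNReal.ofReal_mul (div_nonneg (sub_nonneg.2 haa') hT.le)]
    congr 1
    field_simp
    ring
  have hS : MeasurableSet {x : (ℕ → ℝ) × (ℕ → 𝒵) | ∀ n, ENNReal.ofReal T ≤ scaledTimes r x n} := by
    rw [Set.ofPred_forall]
    exact MeasurableSet.iInter fun n => measurableSet_le measurable_const
      ((measurable_pi_apply n).comp (measurable_scaledTimes hr))
  have hle : ∀ a, markedLaw Q {x | ∀ n, ENNReal.ofReal T ≤ scaledTimes r x n} ≤ G a := by
    intro a
    rw [← lintegral_indicator_one hS]
    refine lintegral_mono fun x => ?_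
    by_cases hx : ∀ n, ENNReal.ofReal T ≤ scaledTimes r x n
    · have : ∀ n, φ a (scaledTimes r x n) = 0 := fun n => if_neg (not_lt.2 (hx n))
      simp [this, hx]
    · rw [Set.indicator_of_notMem (by simpa using hx)]
      exact zero_le
  -- The height diverges as the parameter tends to `T`, so the bound is proved below `T` and passed
  -- to the limit.
  have hlim : Tendsto (fun b => ENNReal.ofReal (Real.exp (-b))) (𝓝[<] T)
      (𝓝 (ENNReal.ofReal (Real.exp (-T)))) :=
    ((ENNReal.continuous_ofReal.comp (by fun_prop : Continuous fun b : ℝ => Real.exp (-b))).tendsto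
      T).mono_left nhdsWithin_le_nhds
  refine ge_of_tendsto hlim ?_
  filter_upwards [Ioo_mem_nhdsLT hT] with b hb
  exact (hle b).trans (hbound b hb.1 hb.2)

end SelectionRules

/-! ### Densities dominating the law of the selected rescaled time. -/

section TimeBounds

variable {𝒵 : Type*} [MeasurableSpace 𝒵]

/-- The density of the rescaled time selected by `powerRule α`. -/
noncomputable def powerDensity (α t : ℝ) : ℝ≥0∞ :=
  ∫⁻ u in Set.Ioi 0, ENNReal.ofReal (Real.exp (-u))
    * ENNReal.ofReal (Real.exp (-(Real.Gamma (1 - α⁻¹) * (t * u ^ α⁻¹))))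

lemma measurable_powerDensity (α : ℝ) : Measurable (powerDensity α) := by
  refine Measurable.lintegral_prod_right' (f := fun p : ℝ × ℝ => ENNReal.ofReal (Real.exp (-p.2))
    * ENNReal.ofReal (Real.exp (-(Real.Gamma (1 - α⁻¹) * (p.1 * p.2 ^ α⁻¹))))) ?_
  fun_prop

/-- The identity 1/(1 + kS) = ∫ e⁻ᵘ e^(-ukS) du expresses a selection probability through the
Laplace transform of the competing weights. For S = ∞ the left side is 0. -/
lemma ofReal_inv_div_add_le_lintegral {k : ℝ} (hk : 0 < k) (S : ℝ≥0∞) :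
    ENNReal.ofReal k⁻¹ / (ENNReal.ofReal k⁻¹ + S)
      ≤ ∫⁻ u in Set.Ioi 0, ENNReal.ofReal (Real.exp (-u)) * expNeg (ENNReal.ofReal (u * k) * S) := by
  by_cases hS : S = ∞
  · simp [hS]
  obtain ⟨s, hs, rfl⟩ : ∃ s : ℝ, 0 ≤ s ∧ S = ENNReal.ofReal s :=
    ⟨S.toReal, ENNReal.toReal_nonneg, (ENNReal.ofReal_toReal hS).symm⟩
  have h1 : 0 < 1 + k * s := by positivity
  have h2 := lintegral_rpow_mul_exp_neg_mul one_pos h1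
  rw [setLIntegral_congr_fun (g := fun u => ENNReal.ofReal (Real.exp (-u))
    * expNeg (ENNReal.ofReal (u * k) * ENNReal.ofReal s)) measurableSet_Ioi] at h2
  · rw [h2, ← ENNReal.ofReal_add (by positivity) hs, ← ENNReal.ofReal_div_of_pos (by positivity)]
    refine ENNReal.ofReal_le_ofReal (le_of_eq ?_)
    simp only [Real.Gamma_one, Real.rpow_one]
    field_simp
  · intro u hu
    have hu : 0 < u := hu
    simp only [sub_self, Real.rpow_zero, one_mul]
    rw [← ENNReal.ofReal_mul (by positivity), expNeg_ofReal (by positivity),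
      ← ENNReal.ofReal_mul (by positivity), ← Real.exp_add]
    ring_nf

lemma lintegral_powerRule_le (Q : Measure 𝒵) [IsProbabilityMeasure Q] {r : 𝒵 → ℝ≥0∞}
    (hr : Measurable r) (hr_int : ∫⁻ z, r z ∂Q = 1) {α t : ℝ} (hα : 1 < α) (ht : 0 < t) :
    ∫⁻ x, powerRule α (ENNReal.ofReal t) (scaledTimes r x) ∂(markedLaw Q) ≤ powerDensity α t := by
  have hα0 : 0 < α := one_pos.trans hα
  have htα : 0 < t ^ α := Real.rpow_pos_of_pos ht _
  have hw : ENNReal.ofReal t ^ (-α) = ENNReal.ofReal (t ^ α)⁻¹ := by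
    rw [ENNReal.ofReal_rpow_of_pos ht, Real.rpow_neg ht.le]
  have hSm : Measurable fun x => ∑' n, scaledTimes r x n ^ (-α) :=
    Measurable.tsum fun n => (((measurable_pi_apply n).comp (measurable_scaledTimes hr)).pow_const _)
  have hm : Measurable fun p : ((ℕ → ℝ) × (ℕ → 𝒵)) × ℝ => ENNReal.ofReal (Real.exp (-p.2))
      * expNeg (ENNReal.ofReal (p.2 * t ^ α) * ∑' n, scaledTimes r p.1 n ^ (-α)) :=
    .mul (by fun_prop) (measurable_expNeg.comp (.mul (by fun_prop) (hSm.comp measurable_fst)))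
  calc ∫⁻ x, powerRule α (ENNReal.ofReal t) (scaledTimes r x) ∂(markedLaw Q)
      ≤ ∫⁻ x, (∫⁻ u in Set.Ioi 0, ENNReal.ofReal (Real.exp (-u))
          * expNeg (ENNReal.ofReal (u * t ^ α) * ∑' n, scaledTimes r x n ^ (-α)))
          ∂(markedLaw Q) := by
        refine lintegral_mono fun x => ?_
        rw [powerRule, hw]
        exact ofReal_inv_div_add_le_lintegral htα _
    _ = ∫⁻ u in Set.Ioi 0, ENNReal.ofReal (Real.exp (-u)) * ∫⁻ x,
          expNeg (ENNReal.ofReal (u * t ^ α) * ∑' n, scaledTimes r x n ^ (-α)) ∂(markedLaw Q) := by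
        rw [lintegral_lintegral_swap hm.aemeasurable]
        simp_rw [lintegral_const_mul' _ _ ENNReal.ofReal_ne_top]
    _ ≤ _ := by
        refine setLIntegral_mono' measurableSet_Ioi fun u hu => ?_
        have hu : 0 < u := hu
        gcongr
        -- The Laplace bound is taken at v = u t^α, so that v^(1/α) = t u^(1/α).
        refine (lintegral_expNeg_tsum_rpow_le Q hr hr_int hα (by positivity)).trans (le_of_eq ?_)
        rw [Real.mul_rpow hu.le htα.le, Real.rpow_rpow_inv ht.le hα0.ne', mul_comm t]

/-- Integrating in `t` first leaves a multiple of e⁻ᵘ u^(-(p+1)/α), a convergent Gamma integral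
because p + 1 < α. The case p = 0 says that the total mass is one. -/
lemma lintegral_rpow_mul_powerDensity {α p : ℝ} (hp : 0 ≤ p) (hpα : p + 1 < α) :
    ∫⁻ t in Set.Ioi 0, ENNReal.ofReal (t ^ p) * powerDensity α t
      = ENNReal.ofReal (Real.Gamma (1 - (p + 1) * α⁻¹) * Real.Gamma (p + 1)
          / Real.Gamma (1 - α⁻¹) ^ (p + 1)) := by
  have hα : 1 < α := by linarith
  have hα0 : 0 < α := by linarith
  have hα1 : α⁻¹ < 1 := inv_lt_one_of_one_lt₀ hα
  have hpα' : (p + 1) * α⁻¹ < 1 := by rwa [← div_eq_mul_inv, div_lt_one hα0]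
  set c := Real.Gamma (1 - α⁻¹)
  have hc : 0 < c := Real.Gamma_pos_of_pos (by linarith)
  have hm : Measurable fun q : ℝ × ℝ => ENNReal.ofReal (q.1 ^ p)
      * (ENNReal.ofReal (Real.exp (-q.2))
        * ENNReal.ofReal (Real.exp (-(c * (q.1 * q.2 ^ α⁻¹))))) := by fun_prop
  unfold powerDensity
  simp_rw [← lintegral_const_mul' _ _ ENNReal.ofReal_ne_top]
  rw [lintegral_lintegral_swap hm.aemeasurable]
  have h1 : ∀ u ∈ Set.Ioi (0 : ℝ), ∫⁻ t in Set.Ioi 0, ENNReal.ofReal (t ^ p)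
      * (ENNReal.ofReal (Real.exp (-u)) * ENNReal.ofReal (Real.exp (-(c * (t * u ^ α⁻¹)))))
      = ENNReal.ofReal (Real.Gamma (p + 1) / c ^ (p + 1))
        * ENNReal.ofReal (Real.exp (-u) * u ^ ((1 - (p + 1) * α⁻¹) - 1)) := by
    intro u hu
    have hu : 0 < u := hu
    have h2 := lintegral_rpow_mul_exp_neg_mul (s := p + 1) (k := c * u ^ α⁻¹) (by linarith)
      (by positivity)
    have h3 : ENNReal.ofReal (Real.Gamma (p + 1) / c ^ (p + 1))
        * ENNReal.ofReal (Real.exp (-u) * u ^ ((1 - (p + 1) * α⁻¹) - 1))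
        = ENNReal.ofReal (Real.exp (-u))
          * ENNReal.ofReal (Real.Gamma (p + 1) / (c * u ^ α⁻¹) ^ (p + 1)) := by
      have hΓ := Real.Gamma_nonneg_of_nonneg (s := p + 1) (by linarith)
      rw [← ENNReal.ofReal_mul (by positivity), ← ENNReal.ofReal_mul (by positivity),
        Real.mul_rpow hc.le (by positivity), ← Real.rpow_mul hu.le, sub_sub_cancel_left,
        Real.rpow_neg hu.le, mul_comm (α⁻¹)]
      congr 1
      field_simp
    rw [h3, ← h2, ← lintegral_const_mul' _ _ ENNReal.ofReal_ne_top]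
    refine setLIntegral_congr_fun measurableSet_Ioi fun t ht => ?_
    have ht : 0 < t := ht
    rw [← ENNReal.ofReal_mul (by positivity), ← ENNReal.ofReal_mul (by positivity),
      ← ENNReal.ofReal_mul (by positivity)]
    congr 1
    rw [add_sub_cancel_right, show c * (t * u ^ α⁻¹) = c * u ^ α⁻¹ * t by ring]
    ring
  have hΓ := Real.Gamma_nonneg_of_nonneg (s := p + 1) (by linarith)
  rw [setLIntegral_congr_fun measurableSet_Ioi h1, lintegral_const_mul' _ _ ENNReal.ofReal_ne_top,
    lintegral_Gamma (by linarith), ← ENNReal.ofReal_mul (by positivity)]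
  congr 1
  ring

lemma lintegral_argminRule_le (Q : Measure 𝒵) [IsProbabilityMeasure Q] {r : 𝒵 → ℝ≥0∞}
    (hr : Measurable r) (hr_int : ∫⁻ z, r z ∂Q = 1) {t : ℝ} (ht : 0 < t) :
    ∫⁻ x, argminRule (ENNReal.ofReal t) (scaledTimes r x) ∂(markedLaw Q)
      ≤ ENNReal.ofReal (Real.exp (-t)) := by
  refine le_trans ?_ (measure_forall_le_scaledTimes_le Q hr hr_int ht)
  have hS : MeasurableSet {x : (ℕ → ℝ) × (ℕ → 𝒵) | ∀ n, ENNReal.ofReal t ≤ scaledTimes r x n} := by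
    rw [Set.ofPred_forall]
    exact MeasurableSet.iInter fun n => measurableSet_le measurable_const
      ((measurable_pi_apply n).comp (measurable_scaledTimes hr))
  rw [← lintegral_indicator_one hS]
  refine lintegral_mono fun x => ?_
  by_cases hx : ∀ n, ENNReal.ofReal t ≤ scaledTimes r x n
  · simp [argminRule, hx]
  · simp [argminRule, hx]

lemma lintegral_rpow_mul_exp_neg {p : ℝ} (hp : 0 ≤ p) :
    ∫⁻ t in Set.Ioi 0, ENNReal.ofReal (t ^ p) * ENNReal.ofReal (Real.exp (-t))
      = ENNReal.ofReal (Real.Gamma (p + 1)) := by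
  rw [← lintegral_Gamma (by linarith : 0 < p + 1)]
  refine setLIntegral_congr_fun measurableSet_Ioi fun t ht => ?_
  rw [add_sub_cancel_right, mul_comm, ENNReal.ofReal_mul (Real.exp_nonneg _)]

end TimeBounds

/-! ### The index and the time of the selected point, by Mecke's formula. -/

section Core

variable {𝒵 : Type*}

/-- The probability that the rule `Ψ` selects the `k`-th point of the configuration `x`. -/
noncomputable def selectProb (Ψ : ℝ≥0∞ → (ℕ → ℝ≥0∞) → ℝ≥0∞) (r : 𝒵 → ℝ≥0∞)
    (x : (ℕ → ℝ) × (ℕ → 𝒵)) (k : ℕ) : ℝ≥0∞ :=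
  Ψ (scaledTimes r x k) (removeAt k (scaledTimes r x))

variable {Ψ : ℝ≥0∞ → (ℕ → ℝ≥0∞) → ℝ≥0∞} {r : 𝒵 → ℝ≥0∞}

/-- Deleting the earlier point `j` moves point `k + 1` to place `k` and takes away one competitor.
-/
lemma IsSelectionRule.selectProb_succ_le (hΨ : IsSelectionRule Ψ) (x : (ℕ → ℝ) × (ℕ → 𝒵))
    {j k : ℕ} (hjk : j ≤ k) :
    selectProb Ψ r x (k + 1) ≤ selectProb Ψ r (removeAt j x.1, removeAt j x.2) k := by
  rw [selectProb, selectProb, ← removeAt_scaledTimes, removeAt_removeAt (Nat.lt_succ_of_le hjk)]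
  have : removeAt j (scaledTimes r x) k = scaledTimes r x (k + 1) := by
    simp [removeAt, skipIndex, not_lt.2 hjk]
  rw [this]
  exact hΨ.le_removeAt _ _ _

variable [MeasurableSpace 𝒵]

lemma IsSelectionRule.measurable_selectProb (hΨ : IsSelectionRule Ψ) (hr : Measurable r) (k : ℕ) :
    Measurable fun x => selectProb Ψ r x k :=
  measurable_uncurry_comp hΨ.measurable
    ((measurable_pi_apply k).comp (measurable_scaledTimes hr))
    ((measurable_removeAt k).comp (measurable_scaledTimes hr))

/-- The expected number of points before the selected one, weighted by a function `φ` of the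
selected time, is at most the expected selected time with the same weight. -/
lemma IsSelectionRule.lintegral_index_le (hΨ : IsSelectionRule Ψ) (Q : Measure 𝒵)
    [IsProbabilityMeasure Q] (hr : Measurable r) {φ : ℝ → ℝ≥0∞} (hφ : Measurable φ) :
    ∫⁻ x, ∑' k : ℕ, (k : ℝ≥0∞) * (φ (x.1 k) * selectProb Ψ r x k) ∂(markedLaw Q)
      ≤ ∫⁻ x, ∑' k : ℕ, ENNReal.ofReal (x.1 k) * (φ (x.1 k) * selectProb Ψ r x k)
          ∂(markedLaw Q) := by
  have hq : ∀ k, Measurable fun x : (ℕ → ℝ) × (ℕ → 𝒵) => φ (x.1 k) * selectProb Ψ r x k :=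
    fun k => .mul (by fun_prop) (hΨ.measurable_selectProb hr k)
  set G : (ℝ × 𝒵) → ((ℕ → ℝ) × (ℕ → 𝒵)) → ℝ≥0∞ := fun p x =>
    ∑' k, if p.1 < x.1 k then φ (x.1 k) * selectProb Ψ r x k else 0 with hG
  have hterm : ∀ k, Measurable fun p : (ℝ × 𝒵) × ((ℕ → ℝ) × (ℕ → 𝒵)) =>
      if p.1.1 < p.2.1 k then φ (p.2.1 k) * selectProb Ψ r p.2 k else 0 := fun k =>
    Measurable.ite (measurableSet_lt (by fun_prop) (by fun_prop)) ((hq k).comp measurable_snd)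
      measurable_const
  have hGm : Measurable (Function.uncurry G) := Measurable.tsum hterm
  have hmono : ∀ᵐ x ∂(markedLaw Q), StrictMono x.1 := by
    have := Measure.quasiMeasurePreserving_fst (μ := arrivalLaw)
      (ν := Measure.infinitePi fun _ : ℕ => Q) |>.ae ae_arrivalLaw_strictMono
    filter_upwards [this] with x hx using hx.2
  calc _ ≤ ∫⁻ x, ∑' j, G (x.1 j, x.2 j) (removeAt j x.1, removeAt j x.2) ∂(markedLaw Q) := by
        refine lintegral_mono_ae ?_
        filter_upwards [hmono] with x hx
        -- The factor `k` is spread over the points j < k, each of which then plays the role of the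
        -- deleted point in Mecke's formula.
        have h1 : ∀ k : ℕ, (k : ℝ≥0∞) * (φ (x.1 k) * selectProb Ψ r x k)
            = ∑' j, if j < k then φ (x.1 k) * selectProb Ψ r x k else 0 := by
          intro k
          rw [tsum_eq_sum (s := Finset.range k) (by simp +contextual),
            Finset.sum_congr rfl (g := fun _ => φ (x.1 k) * selectProb Ψ r x k)
              (fun j hj => if_pos (Finset.mem_range.1 hj))]
          simp
        simp_rw [h1]
        rw [ENNReal.tsum_comm]
        refine ENNReal.tsum_le_tsum fun j => ?_
        -- Point 0 has no predecessor; the others are written as `k + 1`, the index that becomes `k`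
        -- after the deletion.
        rw [tsum_eq_zero_add' ENNReal.summable]
        simp only [not_lt_zero, if_false, zero_add, hG]
        refine ENNReal.tsum_le_tsum fun k => ?_
        by_cases hjk : j < k + 1
        · have hjk' : j ≤ k := Nat.lt_succ_iff.1 hjk
          have h2 : removeAt j x.1 k = x.1 (k + 1) := by
            simp [removeAt, skipIndex, not_lt.2 hjk']
          rw [if_pos hjk, h2, if_pos (hx hjk)]
          gcongr
          exact hΨ.selectProb_succ_le x hjk'
        · simp [hjk]
    _ = ∑' j, ∫⁻ x, G (x.1 j, x.2 j) (removeAt j x.1, removeAt j x.2) ∂(markedLaw Q) :=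
        lintegral_tsum fun j =>
          (measurable_uncurry_comp hGm (by fun_prop) (by fun_prop)).aemeasurable
    _ = ∫⁻ s in Set.Ioi 0, ∫⁻ z, ∫⁻ x, G (s, z) x ∂(markedLaw Q) ∂Q :=
        tsum_lintegral_markedLaw_removeAt Q hGm
    _ = ∫⁻ s in Set.Ioi 0, ∫⁻ x, ∑' k, (if s < x.1 k then φ (x.1 k) * selectProb Ψ r x k else 0)
          ∂(markedLaw Q) := by
        refine lintegral_congr fun s => ?_
        change ∫⁻ _ : 𝒵, (∫⁻ x, ∑' k, (if s < x.1 k then φ (x.1 k) * selectProb Ψ r x k else 0)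
          ∂(markedLaw Q)) ∂Q = _
        rw [lintegral_const, measure_univ, mul_one]
    _ = ∫⁻ x, (∫⁻ s in Set.Ioi 0,
          ∑' k, if s < x.1 k then φ (x.1 k) * selectProb Ψ r x k else 0) ∂(markedLaw Q) := by
        refine lintegral_lintegral_swap (Measurable.aemeasurable ?_)
        exact Measurable.tsum fun k => Measurable.ite
          (measurableSet_lt (by fun_prop) (by fun_prop)) ((hq k).comp measurable_snd)
          measurable_const
    _ = _ := by
        refine lintegral_congr fun x => ?_
        rw [lintegral_tsum fun k => (Measurable.ite measurableSet_Iio measurable_const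
          measurable_const).aemeasurable]
        congr 1
        funext k
        -- The added time `s` ranges over (0, T_k), of length T_k: this produces the time factor.
        have : ∀ s, (if s < x.1 k then φ (x.1 k) * selectProb Ψ r x k else 0)
            = (Set.Iio (x.1 k)).indicator (fun _ => φ (x.1 k) * selectProb Ψ r x k) s := fun s => by
          simp [Set.indicator_apply]
        simp_rw [this]
        rw [lintegral_indicator_const measurableSet_Iio, Measure.restrict_apply measurableSet_Iio,
          Set.inter_comm, Set.Ioi_inter_Iio, Real.volume_Ioo, sub_zero, mul_comm]

/-- The expectation of a function of the selected time. -/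
lemma IsSelectionRule.lintegral_time_le (hΨ : IsSelectionRule Ψ) (Q : Measure 𝒵)
    [IsProbabilityMeasure Q] (hr : Measurable r) (hr_top : ∀ᵐ z ∂Q, r z ≠ ∞) {h : ℝ → ℝ≥0∞}
    (hh : Measurable h) {d : ℝ → ℝ≥0∞}
    (hd : ∀ t, 0 < t → ∫⁻ x, Ψ (ENNReal.ofReal t) (scaledTimes r x) ∂(markedLaw Q) ≤ d t) :
    ∫⁻ x, ∑' k : ℕ, h (x.1 k) * selectProb Ψ r x k ∂(markedLaw Q)
      ≤ ∫⁻ z, r z * (∫⁻ t in Set.Ioi 0, h ((r z).toReal * t) * d t) ∂Q := by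
  have hΨm : Measurable fun p : ℝ≥0∞ × ((ℕ → ℝ) × (ℕ → 𝒵)) => Ψ p.1 (scaledTimes r p.2) :=
    measurable_uncurry_comp hΨ.measurable measurable_fst
      ((measurable_scaledTimes hr).comp measurable_snd)
  set M : ℝ≥0∞ → ℝ≥0∞ := fun a => ∫⁻ x, Ψ a (scaledTimes r x) ∂(markedLaw Q) with hM
  have hMm : Measurable M := Measurable.lintegral_prod_right' hΨm
  have hM_top : M ∞ = 0 := by simp [hM, hΨ.top]
  have hmecke := tsum_lintegral_markedLaw_removeAt Q
    (G := fun p x => h p.1 * Ψ (ENNReal.ofReal p.1 / r p.2) (scaledTimes r x))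
    (.mul (by fun_prop) (hΨm.comp (f := fun p : (ℝ × 𝒵) × ((ℕ → ℝ) × (ℕ → 𝒵)) =>
      (ENNReal.ofReal p.1.1 / r p.1.2, p.2)) (by fun_prop)))
  have hkm : ∀ k, Measurable fun x : (ℕ → ℝ) × (ℕ → 𝒵) => h (x.1 k) * selectProb Ψ r x k :=
    fun k => .mul (by fun_prop) (hΨ.measurable_selectProb hr k)
  rw [lintegral_tsum fun k => (hkm k).aemeasurable]
  change (∑' k, ∫⁻ x, h (x.1 k) * Ψ (ENNReal.ofReal (x.1 k) / r (x.2 k))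
    (scaledTimes r (removeAt k x.1, removeAt k x.2)) ∂(markedLaw Q)) ≤ _
  rw [hmecke]
  -- The true time is rewritten as the density times the rescaled time, so that
  -- `lintegral_scaledTime` applies. Where the density is zero this rewriting fails, but both sides
  -- vanish by the value of the rule at ∞.
  calc _ = ∫⁻ s in Set.Ioi 0, ∫⁻ z, h (r z * (ENNReal.ofReal s / r z)).toReal
        * M (ENNReal.ofReal s / r z) ∂Q := by
        refine setLIntegral_congr_fun measurableSet_Ioi fun s hs => ?_
        have hs : 0 < s := hs
        refine lintegral_congr_ae ?_
        filter_upwards [hr_top] with z hz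
        have hΨs : Measurable fun x => Ψ (ENNReal.ofReal s / r z) (scaledTimes r x) :=
          hΨm.comp measurable_prodMk_left
        rw [lintegral_const_mul _ hΨs]
        by_cases h0 : r z = 0
        · simp only [h0]
          rw [ENNReal.div_zero (by simpa using hs)]
          simp [hΨ.top, hM_top]
        · rw [ENNReal.mul_div_cancel h0 hz, ENNReal.toReal_ofReal hs.le]
    _ = ∫⁻ z, r z * (∫⁻ t in Set.Ioi 0, h (r z * ENNReal.ofReal t).toReal
        * M (ENNReal.ofReal t)) ∂Q :=
        lintegral_scaledTime Q hr hr_top (F := fun y z => h (r z * y).toReal * M y)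
          (by fun_prop) (by simp [hM_top])
    _ ≤ _ := by
        refine lintegral_mono fun z => ?_
        gcongr 1
        refine setLIntegral_mono' measurableSet_Ioi fun t ht => ?_
        have ht : 0 < t := ht
        rw [ENNReal.toReal_mul, ENNReal.toReal_ofReal ht.le]
        gcongr
        exact hd t ht

end Core

/-! ### From the selected time to the divergence. -/

section LogBound

/-- Subadditivity of x^η gives log(1 + x) ≤ log(1 + x^η)/η. Taking out ρ^η leaves ρ^(-η) + t^η,
where log lies below its tangent at 1 + C. Since ρ log ρ = `klFun ρ` + ρ - 1 and the tangent
contributes -ρ/η, the negative terms are moved to the left, ready for integration in `ℝ≥0∞`. -/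
lemma mul_log_one_add_mul_le {ρ t η C : ℝ} (hρ : 0 ≤ ρ) (ht : 0 < t) (hη : 0 < η) (hη1 : η ≤ 1)
    (hC : 0 ≤ C) :
    ρ * Real.log (1 + ρ * t) + (ρ / η + 1)
      ≤ klFun ρ + ρ + ρ * (Real.log (1 + C) / η)
        + (η + (1 - η) * ρ + ρ * t ^ η) / (η * (1 + C)) := by
  rcases hρ.eq_or_lt with rfl | hρ
  · have : 0 ≤ η / (η * (1 + C)) := by positivity
    simpa [klFun] using this
  have hx : 0 < ρ * t := by positivity
  have hC' : 0 < 1 + C := by positivity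
  have h1 : Real.log (1 + ρ * t) ≤ Real.log (1 + (ρ * t) ^ η) / η := by
    rw [le_div_iff₀ hη, mul_comm, ← Real.log_rpow (by positivity)]
    refine Real.log_le_log (by positivity) ?_
    simpa using Real.rpow_add_le_add_rpow (p := η) zero_le_one hx.le hη.le hη1
  have h2 : Real.log (1 + (ρ * t) ^ η)
      ≤ η * Real.log ρ + Real.log (1 + C) + ((ρ ^ η)⁻¹ + t ^ η) / (1 + C) - 1 := by
    have e : 1 + (ρ * t) ^ η = ρ ^ η * ((1 + C) * (((ρ ^ η)⁻¹ + t ^ η) / (1 + C))) := by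
      rw [Real.mul_rpow hρ.le ht.le]
      have : ρ ^ η ≠ 0 := (Real.rpow_pos_of_pos hρ _).ne'
      field_simp
    have hpos : 0 < ((ρ ^ η)⁻¹ + t ^ η) / (1 + C) := by positivity
    rw [e, Real.log_mul (by positivity) (by positivity), Real.log_mul hC'.ne' hpos.ne',
      Real.log_rpow hρ]
    linarith [Real.log_le_sub_one_of_pos hpos]
  -- Bernoulli's inequality for ρ^(1-η); integrated against Q it says that the P-mean of ρ^(-η) is
  -- at most 1.
  have h3 : ρ * (ρ ^ η)⁻¹ ≤ η + (1 - η) * ρ := by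
    have := rpow_one_add_le_one_add_mul_self (s := ρ - 1) (by linarith)
      (sub_nonneg.2 hη1) (by linarith : 1 - η ≤ 1)
    rw [add_sub_cancel, Real.rpow_sub hρ, Real.rpow_one, div_eq_mul_inv] at this
    linarith
  have h4 : ρ * Real.log (1 + ρ * t) ≤ ρ * ((η * Real.log ρ + Real.log (1 + C)
      + ((ρ ^ η)⁻¹ + t ^ η) / (1 + C) - 1) / η) := by
    gcongr
    exact h1.trans (by gcongr)
  have h5 : ρ * ((η * Real.log ρ + Real.log (1 + C) + ((ρ ^ η)⁻¹ + t ^ η) / (1 + C) - 1) / η)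
      = ρ * Real.log ρ + ρ * (Real.log (1 + C) / η)
        + (ρ * (ρ ^ η)⁻¹ + ρ * t ^ η) / (η * (1 + C)) - ρ / η := by
    field_simp
  have h6 : (ρ * (ρ ^ η)⁻¹ + ρ * t ^ η) / (η * (1 + C))
      ≤ (η + (1 - η) * ρ + ρ * t ^ η) / (η * (1 + C)) := by gcongr
  rw [klFun]
  linarith

/-- Averaging `r log (1 + r t)` over a probability density `d` of `t` with `η`-th moment `C`. -/
lemma mul_lintegral_log_one_add_le {ρ η C : ℝ} (hρ : 0 ≤ ρ) (hη : 0 < η) (hη1 : η ≤ 1)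
    (hC : 0 ≤ C) {d : ℝ → ℝ≥0∞} (hd : Measurable d) (hd1 : ∫⁻ t in Set.Ioi 0, d t = 1)
    (hdη : ∫⁻ t in Set.Ioi 0, ENNReal.ofReal (t ^ η) * d t = ENNReal.ofReal C) :
    ENNReal.ofReal ρ * (∫⁻ t in Set.Ioi 0, ENNReal.ofReal (Real.log (1 + ρ * t)) * d t)
        + ENNReal.ofReal (ρ / η + 1)
      ≤ ENNReal.ofReal (klFun ρ) + ENNReal.ofReal ((1 + C)⁻¹
        + (1 + Real.log (1 + C) / η + (1 - η + C) / (η * (1 + C))) * ρ) := by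
  have hη1' : 0 ≤ 1 - η := sub_nonneg.2 hη1
  have hlogC : 0 ≤ Real.log (1 + C) := Real.log_nonneg (by linarith)
  have hkl := klFun_nonneg hρ
  set A := klFun ρ + ρ + ρ * (Real.log (1 + C) / η) + (η + (1 - η) * ρ) / (η * (1 + C))
  have hA : 0 ≤ A := by positivity
  set B := ρ / (η * (1 + C))
  have hB : 0 ≤ B := by positivity
  calc _ = ∫⁻ t in Set.Ioi 0, (ENNReal.ofReal ρ * (ENNReal.ofReal (Real.log (1 + ρ * t)) * d t)
          + ENNReal.ofReal (ρ / η + 1) * d t) := by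
        rw [lintegral_add_right _ (by fun_prop), lintegral_const_mul' _ _ ENNReal.ofReal_ne_top,
          lintegral_const_mul' _ _ ENNReal.ofReal_ne_top, hd1, mul_one]
    _ ≤ ∫⁻ t in Set.Ioi 0, (ENNReal.ofReal A * d t
          + ENNReal.ofReal B * (ENNReal.ofReal (t ^ η) * d t)) := by
        refine setLIntegral_mono' measurableSet_Ioi fun t ht => ?_
        have ht : 0 < t := ht
        have hlog : 0 ≤ Real.log (1 + ρ * t) := Real.log_nonneg (by nlinarith)
        have := mul_log_one_add_mul_le hρ ht hη hη1 hC
        rw [← mul_assoc, ← mul_assoc, ← add_mul, ← add_mul, ← ENNReal.ofReal_mul hρ,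
          ← ENNReal.ofReal_mul hB, ← ENNReal.ofReal_add (by positivity) (by positivity),
          ← ENNReal.ofReal_add hA (by positivity)]
        refine mul_le_mul_left (ENNReal.ofReal_le_ofReal (this.trans (le_of_eq ?_))) _
        simp only [A, B]
        ring
    _ = ENNReal.ofReal (A + B * C) := by
        rw [lintegral_add_left (by fun_prop), lintegral_const_mul' _ _ ENNReal.ofReal_ne_top,
          lintegral_const_mul' _ _ ENNReal.ofReal_ne_top, hd1, hdη, mul_one,
          ← ENNReal.ofReal_mul hB, ← ENNReal.ofReal_add hA (by positivity)]
    _ = _ := by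
        rw [← ENNReal.ofReal_add hkl (by positivity)]
        congr 1
        simp only [A, B]
        field_simp
        ring

/-- This is log x ≤ x - 1 at x = (k+1)/(1+T), written without subtraction. The zero-based index `k`
is the number of earlier points. -/
lemma log_add_one_add_div_le {T : ℝ} (hT : 0 < T) (k : ℕ) :
    ENNReal.ofReal (Real.log (k + 1)) + ENNReal.ofReal T * ENNReal.ofReal (1 / (1 + T))
      ≤ ENNReal.ofReal (Real.log (1 + T)) + k * ENNReal.ofReal (1 / (1 + T)) := by
  have h1 : 0 ≤ Real.log ((k : ℝ) + 1) := Real.log_nonneg (by simp)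
  have h2 : 0 ≤ Real.log (1 + T) := Real.log_nonneg (by linarith)
  rw [← ENNReal.ofReal_mul hT.le, ← ENNReal.ofReal_natCast, ← ENNReal.ofReal_mul k.cast_nonneg,
    ← ENNReal.ofReal_add h1 (by positivity), ← ENNReal.ofReal_add h2 (by positivity)]
  refine ENNReal.ofReal_le_ofReal ?_
  have h3 := Real.log_le_sub_one_of_pos (x := ((k : ℝ) + 1) / (1 + T)) (by positivity)
  rw [Real.log_div (by positivity) (by positivity)] at h3
  have h4 : ((k : ℝ) + 1) / (1 + T) - 1 = k * (1 / (1 + T)) - T * (1 / (1 + T)) := by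
    field_simp
    ring
  linarith

variable {𝒵 : Type*} [MeasurableSpace 𝒵] {Ψ : ℝ≥0∞ → (ℕ → ℝ≥0∞) → ℝ≥0∞} {r : 𝒵 → ℝ≥0∞}

/-- Averaging `log_add_one_add_div_le` leaves the corrections `A` and `B` with weight 1/(1+t); they
satisfy A ≤ B by `IsSelectionRule.lintegral_index_le`. -/
lemma IsSelectionRule.lintegral_log_index_le_log_time (hΨ : IsSelectionRule Ψ) (Q : Measure 𝒵)
    [IsProbabilityMeasure Q] (hr : Measurable r) (hr_int : ∫⁻ z, r z ∂Q = 1) {d : ℝ → ℝ≥0∞}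
    (hd1 : ∫⁻ t in Set.Ioi 0, d t = 1)
    (hΨd : ∀ t, 0 < t → ∫⁻ x, Ψ (ENNReal.ofReal t) (scaledTimes r x) ∂(markedLaw Q) ≤ d t) :
    ∫⁻ x, ∑' k : ℕ, ENNReal.ofReal (Real.log (k + 1)) * selectProb Ψ r x k ∂(markedLaw Q)
      ≤ ∫⁻ x, ∑' k : ℕ, ENNReal.ofReal (Real.log (1 + x.1 k)) * selectProb Ψ r x k
          ∂(markedLaw Q) := by
  have hr_top : ∀ᵐ z ∂Q, r z ≠ ∞ := by
    filter_upwards [ae_lt_top hr (by simp [hr_int])] with z hz using hz.ne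
  set φ : ℝ → ℝ≥0∞ := fun t => ENNReal.ofReal (1 / (1 + t)) with hφ
  have hφm : Measurable φ := by fun_prop
  have hq := fun k => hΨ.measurable_selectProb hr k
  have hpos : ∀ᵐ x ∂(markedLaw Q), ∀ k, 0 < x.1 k := by
    have := Measure.quasiMeasurePreserving_fst (μ := arrivalLaw)
      (ν := Measure.infinitePi fun _ : ℕ => Q) |>.ae ae_arrivalLaw_strictMono
    filter_upwards [this] with x hx k using hx.1.trans_le (hx.2.monotone (Nat.zero_le k))
  set A := ∫⁻ x, ∑' k : ℕ, (k : ℝ≥0∞) * (φ (x.1 k) * selectProb Ψ r x k) ∂(markedLaw Q)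
  set B := ∫⁻ x, ∑' k : ℕ, ENNReal.ofReal (x.1 k) * (φ (x.1 k) * selectProb Ψ r x k)
    ∂(markedLaw Q)
  have hAB : A ≤ B := hΨ.lintegral_index_le Q hr hφm
  -- Finiteness is what allows `B` to be cancelled. Since t/(1+t) ≤ 1, `B` is at most the total
  -- selected mass, which is at most 1.
  have hB : B ≠ ∞ := by
    refine ne_top_of_le_ne_top ENNReal.one_ne_top ?_
    calc B ≤ ∫⁻ x, ∑' k : ℕ, (fun _ => 1 : ℝ → ℝ≥0∞) (x.1 k) * selectProb Ψ r x k
          ∂(markedLaw Q) := by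
          refine lintegral_mono_ae ?_
          filter_upwards [hpos] with x hx
          refine ENNReal.tsum_le_tsum fun k => ?_
          have := hx k
          rw [← mul_assoc, hφ, ← ENNReal.ofReal_mul this.le]
          gcongr
          rw [ENNReal.ofReal_le_one, mul_one_div, div_le_one (by positivity)]
          linarith
      _ ≤ _ := hΨ.lintegral_time_le Q hr hr_top measurable_const hΨd
      _ = 1 := by simp [hd1, hr_int]
  refine (ENNReal.add_le_add_iff_right hB).1 ?_
  have hkm : ∀ f : ℕ → ((ℕ → ℝ) × (ℕ → 𝒵)) → ℝ≥0∞, (∀ k, Measurable (f k)) →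
      Measurable fun x => ∑' k, f k x * selectProb Ψ r x k :=
    fun f hf => Measurable.tsum fun k => (hf k).mul (hq k)
  calc _ = ∫⁻ x, ((∑' k : ℕ, ENNReal.ofReal (Real.log (k + 1)) * selectProb Ψ r x k)
          + ∑' k : ℕ, ENNReal.ofReal (x.1 k) * (φ (x.1 k) * selectProb Ψ r x k))
          ∂(markedLaw Q) :=
        (lintegral_add_left (hkm _ fun k => measurable_const) _).symm
    _ ≤ ∫⁻ x, ((∑' k : ℕ, ENNReal.ofReal (Real.log (1 + x.1 k)) * selectProb Ψ r x k)
          + ∑' k : ℕ, (k : ℝ≥0∞) * (φ (x.1 k) * selectProb Ψ r x k)) ∂(markedLaw Q) := by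
        refine lintegral_mono_ae ?_
        filter_upwards [hpos] with x hx
        rw [← ENNReal.tsum_add, ← ENNReal.tsum_add]
        refine ENNReal.tsum_le_tsum fun k => ?_
        rw [← mul_assoc, ← mul_assoc, ← add_mul, ← add_mul]
        exact mul_le_mul_left (log_add_one_add_div_le (hx k) k) _
    _ = _ := lintegral_add_left (hkm _ fun k => by fun_prop) _
    _ ≤ _ := by gcongr

/-- The expected logarithm of the selected index, for a selection rule whose selected rescaled time
has a law dominated by a probability density `d` with `η`-th moment `C`. -/
theorem IsSelectionRule.lintegral_log_index_le (hΨ : IsSelectionRule Ψ) (Q : Measure 𝒵)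
    [IsProbabilityMeasure Q] (hr : Measurable r) (hr_int : ∫⁻ z, r z ∂Q = 1) {η C : ℝ}
    (hη : 0 < η) (hη1 : η ≤ 1) (hC : 0 ≤ C) {d : ℝ → ℝ≥0∞} (hd : Measurable d)
    (hd1 : ∫⁻ t in Set.Ioi 0, d t = 1)
    (hdη : ∫⁻ t in Set.Ioi 0, ENNReal.ofReal (t ^ η) * d t = ENNReal.ofReal C)
    (hΨd : ∀ t, 0 < t → ∫⁻ x, Ψ (ENNReal.ofReal t) (scaledTimes r x) ∂(markedLaw Q) ≤ d t) :
    ∫⁻ x, ∑' k : ℕ, ENNReal.ofReal (Real.log (k + 1)) * selectProb Ψ r x k ∂(markedLaw Q)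
      ≤ (∫⁻ z, ENNReal.ofReal (klFun (r z).toReal) ∂Q)
        + ENNReal.ofReal (Real.log (1 + C) / η) := by
  have hr_top : ∀ᵐ z ∂Q, r z ≠ ∞ := by
    filter_upwards [ae_lt_top hr (by simp [hr_int])] with z hz using hz.ne
  have hη1' : 0 ≤ 1 - η := sub_nonneg.2 hη1
  have hlogC : 0 ≤ Real.log (1 + C) := Real.log_nonneg (by linarith)
  refine (hΨ.lintegral_log_index_le_log_time Q hr hr_int hd1 hΨd).trans ?_
  refine (hΨ.lintegral_time_le Q hr hr_top (h := fun t => ENNReal.ofReal (Real.log (1 + t)))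
    (by fun_prop) hΨd).trans ?_
  set L := ∫⁻ z, r z * (∫⁻ t in Set.Ioi 0,
    ENNReal.ofReal (Real.log (1 + (r z).toReal * t)) * d t) ∂Q
  set c := 1 + Real.log (1 + C) / η + (1 - η + C) / (η * (1 + C))
  have hc : 0 ≤ c := by positivity
  have hKL : Measurable fun z => ENNReal.ofReal (klFun (r z).toReal) :=
    (measurable_klFun.comp hr.ennreal_toReal).ennreal_ofReal
  have h1 : L + ENNReal.ofReal (η⁻¹ + 1)
      ≤ (∫⁻ z, ENNReal.ofReal (klFun (r z).toReal) ∂Q) + ENNReal.ofReal ((1 + C)⁻¹ + c) := by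
    simp only [L]
    calc _ = ∫⁻ z, (r z * (∫⁻ t in Set.Ioi 0,
            ENNReal.ofReal (Real.log (1 + (r z).toReal * t)) * d t)
            + (ENNReal.ofReal η⁻¹ * r z + 1)) ∂Q := by
          rw [lintegral_add_right _ (by fun_prop), lintegral_add_right _ measurable_const,
            lintegral_const_mul _ hr, hr_int, mul_one, ENNReal.ofReal_add (by positivity) zero_le_one]
          simp
      _ ≤ ∫⁻ z, (ENNReal.ofReal (klFun (r z).toReal)
            + (ENNReal.ofReal (1 + C)⁻¹ + ENNReal.ofReal c * r z)) ∂Q := by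
          refine lintegral_mono_ae ?_
          filter_upwards [hr_top] with z hz
          have := mul_lintegral_log_one_add_le (ρ := (r z).toReal) ENNReal.toReal_nonneg hη hη1 hC
            hd hd1 hdη
          rw [ENNReal.ofReal_add (by positivity) zero_le_one,
            ENNReal.ofReal_add (by positivity) (by positivity), div_eq_inv_mul,
            ENNReal.ofReal_mul (by positivity), ENNReal.ofReal_mul hc, ENNReal.ofReal_toReal hz,
            ENNReal.ofReal_one] at this
          exact this
      _ = _ := by
          rw [lintegral_add_left hKL, lintegral_add_left measurable_const,
            lintegral_const_mul _ hr, hr_int, mul_one, ENNReal.ofReal_add (by positivity) hc]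
          simp
  -- The tangent was taken at 1 + C precisely so that the leftover constants add up to η⁻¹ + 1, the
  -- term added on the left.
  have h2 : (1 + C)⁻¹ + c = Real.log (1 + C) / η + (η⁻¹ + 1) := by
    simp only [c]
    field_simp
    ring
  rw [h2, ENNReal.ofReal_add (q := η⁻¹ + 1) (by positivity) (by positivity), ← add_assoc] at h1
  exact (ENNReal.add_le_add_iff_right ENNReal.ofReal_ne_top).1 h1

end LogBound

/-! ### Numerical bounds on the Gamma function and the constant 3.56. -/

section GammaBounds

lemma le_Gamma_three_halves : 0.886 ≤ Real.Gamma (3 / 2) := by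
  have h : Real.Gamma (3 / 2) = √Real.pi / 2 := by
    rw [show (3 / 2 : ℝ) = 1 / 2 + 1 by norm_num, Real.Gamma_add_one (by norm_num),
      Real.Gamma_one_half_eq]
    ring
  have h1 : (1.772 : ℝ) ≤ √Real.pi :=
    Real.le_sqrt_of_sq_le (by norm_num; linarith [Real.pi_gt_d6])
  rw [h]
  linarith

lemma Gamma_le_one {x : ℝ} (h1 : 1 ≤ x) (h2 : x ≤ 2) : Real.Gamma x ≤ 1 := by
  have h := Real.convexOn_Gamma.le_max_of_mem_Icc (x := 1) (y := 2) (z := x) (by simp) (by simp)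
    ⟨h1, h2⟩
  simpa using h

/-- The tangent of the convex function Γ at 1 has slope -γ, and γ < 2/3. -/
lemma one_sub_mul_le_Gamma {s : ℝ} (h0 : 0 ≤ s) : 1 - 2 / 3 * s ≤ Real.Gamma (1 + s) := by
  rcases h0.eq_or_lt with rfl | h0
  · simp
  have h := Real.convexOn_Gamma.le_slope_of_hasDerivAt (x := 1) (y := 1 + s) (by simp)
    (Set.mem_Ioi.2 (by linarith)) (by linarith) Real.hasDerivAt_Gamma_one
  rw [slope_def_field, Real.Gamma_one, add_sub_cancel_left, le_div_iff₀ h0] at h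
  nlinarith [Real.eulerMascheroniConstant_lt_two_thirds]

/-- To the left of 3/2, Γ lies above its secant through 3/2 and 2, whose slope is at most (1 -
0.886)/(1/2) = 0.228. -/
lemma le_Gamma_one_add_of_le_half {s : ℝ} (h0 : 0 ≤ s) (h1 : s ≤ 1 / 2) :
    0.772 + 0.228 * s ≤ Real.Gamma (1 + s) := by
  have hG := le_Gamma_three_halves
  rcases h1.eq_or_lt with rfl | h1
  · norm_num at hG ⊢
    linarith
  have h := Real.convexOn_Gamma.slope_mono_adjacent (x := 1 + s) (y := 3 / 2) (z := 2)
    (Set.mem_Ioi.2 (by linarith)) (by simp) (by linarith) (by norm_num)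
  rw [div_le_iff₀ (by linarith), Real.Gamma_two, show (2 : ℝ) - 3 / 2 = 1 / 2 by norm_num] at h
  nlinarith [mul_nonneg (sub_nonneg.2 hG) (sub_nonneg.2 h1.le)]

/-- To the right of 3/2, Γ lies above its secant through 1 and 3/2, whose slope is at least -0.228.
-/
lemma le_Gamma_one_add_of_half_le {s : ℝ} (h0 : 1 / 2 ≤ s) :
    1 - 0.228 * s ≤ Real.Gamma (1 + s) := by
  have hG := le_Gamma_three_halves
  rcases h0.eq_or_lt with rfl | h0
  · norm_num at hG ⊢
    linarith
  have h := Real.convexOn_Gamma.slope_mono_adjacent (x := 1) (y := 3 / 2) (z := 1 + s)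
    (by simp) (Set.mem_Ioi.2 (by linarith)) (by norm_num) (by linarith)
  rw [le_div_iff₀ (by linarith), Real.Gamma_one, show (3 / 2 : ℝ) - 1 = 1 / 2 by norm_num] at h
  nlinarith [mul_nonneg (sub_nonneg.2 hG) (sub_nonneg.2 h0.le)]

/-- The constant is 2/2.56, as `Gamma_ratio_le_of_third_lt` requires. -/
lemma le_Gamma_one_add {s : ℝ} (h0 : 0 ≤ s) (h1 : s ≤ 2 / 3) :
    0.78125 ≤ Real.Gamma (1 + s) := by
  rcases le_total s 0.1 with h | h
  · linarith [one_sub_mul_le_Gamma h0]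
  rcases le_total s (1 / 2) with h' | h'
  · linarith [le_Gamma_one_add_of_le_half h0 h']
  · linarith [le_Gamma_one_add_of_half_le h']

/-- The case η = 1 with u = 1/α. The recursion moves the arguments into [1, 2]; with Γ(2-u) ≥ 0.772
and 0.772² ≥ 0.595 a quadratic inequality in `u` remains. -/
lemma Gamma_ratio_le_of_le_third {u : ℝ} (h0 : 0 ≤ u) (h1 : u ≤ 1 / 3) :
    Real.Gamma (1 - (1 + 1) * u) * Real.Gamma (1 + 1) / Real.Gamma (1 - u) ^ ((1 : ℝ) + 1)
      ≤ 2.56 := by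
  have e1 : Real.Gamma (1 - (1 + 1) * u) = Real.Gamma (2 - 2 * u) / (1 - 2 * u) := by
    rw [show 2 - 2 * u = (1 - 2 * u) + 1 by ring, Real.Gamma_add_one (by linarith),
      mul_div_cancel_left₀ _ (by linarith)]
    ring_nf
  have e2 : Real.Gamma (1 - u) = Real.Gamma (2 - u) / (1 - u) := by
    rw [show 2 - u = (1 - u) + 1 by ring, Real.Gamma_add_one (by linarith),
      mul_div_cancel_left₀ _ (by linarith)]
  have h2 : Real.Gamma (2 - 2 * u) ≤ 1 := Gamma_le_one (by linarith) (by linarith)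
  have h3 : 0.772 ≤ Real.Gamma (2 - u) := by
    have := le_Gamma_one_add_of_half_le (s := 1 - u) (by linarith)
    rw [show 2 - u = 1 + (1 - u) by ring]
    linarith
  have e3 : Real.Gamma (1 + 1) = 1 := by rw [one_add_one_eq_two, Real.Gamma_two]
  have hu : 0 < 1 - u := by linarith
  have hu2 : 0 < 1 - 2 * u := by linarith
  have hpos : 0 < Real.Gamma (2 - u) := by linarith
  rw [e1, e2, e3, one_add_one_eq_two, Real.rpow_two, mul_one, div_le_iff₀ (by positivity),
    div_le_iff₀ hu2, div_pow]
  have h4 : (0.595 : ℝ) ≤ Real.Gamma (2 - u) ^ 2 := by nlinarith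
  have h5 : 0.595 / (1 - u) ^ 2 ≤ Real.Gamma (2 - u) ^ 2 / (1 - u) ^ 2 := by gcongr
  refine h2.trans ?_
  have h6 : 1 ≤ 2.56 * (0.595 / (1 - u) ^ 2) * (1 - 2 * u) := by
    rw [mul_div_assoc', div_mul_eq_mul_div, le_div_iff₀ (by positivity)]
    nlinarith
  refine h6.trans ?_
  gcongr

/-- For η = (α-1)/2 and s = 1 - u the first argument is s/2. The numerator is at most 2/s, and the
denominator at least Γ(s) = Γ(1+s)/s because Γ(s) ≥ 1; the singular factors 1/s cancel. -/
lemma Gamma_ratio_le_of_third_lt {u η : ℝ} (h0 : 1 / 3 ≤ u) (h1 : u < 1)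
    (hη : η = (u⁻¹ - 1) / 2) :
    Real.Gamma (1 - (η + 1) * u) * Real.Gamma (η + 1) / Real.Gamma (1 - u) ^ (η + 1) ≤ 2.56 := by
  set s := 1 - u with hs
  have hs0 : 0 < s := by linarith
  have hs1 : s ≤ 2 / 3 := by linarith
  have hu : 0 < u := by linarith
  have hu1 : 1 < u⁻¹ := (one_lt_inv₀ hu).2 h1
  have hu3 : u⁻¹ ≤ 3 := by
    rw [inv_le_comm₀ hu (by norm_num)]
    linarith
  have hη0 : 0 < η := by linarith
  have hη1 : η ≤ 1 := by linarith
  have e1 : Real.Gamma (1 - (η + 1) * u) = 2 / s * Real.Gamma (1 + s / 2) := by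
    have : 1 - (η + 1) * u = s / 2 := by
      rw [hη, hs]
      field_simp
      ring
    rw [this, add_comm, Real.Gamma_add_one (by positivity)]
    field_simp
  have e2 : Real.Gamma s = Real.Gamma (1 + s) / s := by
    rw [add_comm, Real.Gamma_add_one hs0.ne', mul_div_cancel_left₀ _ hs0.ne']
  have hG := le_Gamma_one_add hs0.le hs1
  have hGpos : 0 < Real.Gamma (1 + s) := by linarith
  have hGs : 1 ≤ Real.Gamma s := by
    rw [e2, one_le_div hs0]
    linarith
  have h3 : Real.Gamma s ≤ Real.Gamma s ^ (η + 1) := by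
    simpa using Real.rpow_le_rpow_of_exponent_le hGs (by linarith : (1 : ℝ) ≤ η + 1)
  have h4 : Real.Gamma (1 + s / 2) ≤ 1 := Gamma_le_one (by linarith) (by linarith)
  have h5 : Real.Gamma (η + 1) ≤ 1 := Gamma_le_one (by linarith) (by linarith)
  have h6 := Real.Gamma_nonneg_of_nonneg (s := η + 1) (by linarith)
  rw [e1, div_le_iff₀ (by positivity)]
  calc _ ≤ 2 / s * 1 * 1 := by gcongr
    _ ≤ 2.56 * Real.Gamma s := by
      rw [e2, mul_one, mul_one, mul_div_assoc', div_le_div_iff_of_pos_right hs0]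
      linarith
    _ ≤ _ := by gcongr

lemma gamma_ratio_nonneg {α : ℝ≥0∞} {η : ℝ} (hα : 1 < α) (hη : 0 < η)
    (hηα : ENNReal.ofReal η < α - 1) :
    0 ≤ Real.Gamma (1 - (η + 1) * (α⁻¹).toReal) * Real.Gamma (η + 1)
        / Real.Gamma (1 - (α⁻¹).toReal) ^ (η + 1) := by
  have hu : (α⁻¹).toReal < 1 := by
    rw [← ENNReal.toReal_one]
    exact (ENNReal.toReal_lt_toReal (by simpa using (zero_lt_one.trans hα).ne') (by simp)).2
      (ENNReal.inv_lt_one.2 hα)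
  have hηu : (η + 1) * (α⁻¹).toReal < 1 := by
    rcases eq_or_ne α ∞ with rfl | hαt
    · simp
    have h1 : ENNReal.ofReal (η + 1) < α := by
      rw [ENNReal.ofReal_add hη.le zero_le_one, ENNReal.ofReal_one]
      exact lt_tsub_iff_right.1 hηα
    rw [ENNReal.toReal_inv, ← div_eq_mul_inv,
      div_lt_one (ENNReal.toReal_pos (zero_lt_one.trans hα).ne' hαt)]
    exact (ENNReal.ofReal_lt_iff_lt_toReal (by positivity) hαt).1 h1
  exact div_nonneg (mul_nonneg (Real.Gamma_nonneg_of_nonneg (by linarith))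
      (Real.Gamma_nonneg_of_nonneg (by linarith)))
      (Real.rpow_nonneg (Real.Gamma_nonneg_of_nonneg (by linarith)) _)

lemma gammaBound_le_simpleBound {b : ℝ} (hb : 1 < b) {α : ℝ≥0∞} (hα : 1 < α) :
    gammaBound b α ≤ simpleBound b α := by
  have key : ∀ η : ℝ, 0 < η → η ≤ 1 → ENNReal.ofReal η < α - 1 →
      min ((α - 1) / 2) 1 = ENNReal.ofReal η →
      Real.Gamma (1 - (η + 1) * (α⁻¹).toReal) * Real.Gamma (η + 1)
        / Real.Gamma (1 - (α⁻¹).toReal) ^ (η + 1) ≤ 2.56 →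
      gammaBound b α ≤ simpleBound b α := by
    intro η hη hη1 hηα hmin hratio
    refine (iInf₂_le η ⟨hη, hη1, hηα⟩).trans ?_
    rw [simpleBound, hmin, ← ENNReal.ofReal_div_of_pos hη]
    refine ENNReal.ofReal_le_ofReal ?_
    rw [one_div_mul_eq_div]
    have hpos := gamma_ratio_nonneg hα hη hηα
    refine div_le_div_of_nonneg_right (Real.logb_le_logb_of_le hb (by linarith) ?_) hη.le
    linarith
  rcases le_or_gt 3 α with h3 | h3
  · have h2 : (2 : ℝ≥0∞) ≤ α - 1 := by
      refine ENNReal.le_sub_of_add_le_right ENNReal.one_ne_top ?_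
      rwa [two_add_one_eq_three]
    refine key 1 one_pos le_rfl ?_ ?_ (Gamma_ratio_le_of_le_third ENNReal.toReal_nonneg ?_)
    · rw [ENNReal.ofReal_one]
      exact lt_of_lt_of_le (by norm_num) h2
    · rw [ENNReal.ofReal_one, min_eq_right]
      rw [ENNReal.le_div_iff_mul_le (by simp) (by simp), one_mul]
      exact h2
    · have : α⁻¹ ≤ 3⁻¹ := ENNReal.inv_le_inv.2 h3
      have := ENNReal.toReal_mono (by simp) this
      simpa using this
  · have hαt : α ≠ ∞ := ne_top_of_lt h3
    obtain ⟨a, ha, rfl⟩ : ∃ a : ℝ, 0 ≤ a ∧ α = ENNReal.ofReal a :=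
      ⟨α.toReal, ENNReal.toReal_nonneg, (ENNReal.ofReal_toReal hαt).symm⟩
    have ha1 : 1 < a := by
      rwa [← ENNReal.ofReal_one, ENNReal.ofReal_lt_ofReal_iff_of_nonneg zero_le_one] at hα
    have ha3 : a < 3 := by
      rwa [← ENNReal.ofReal_ofNat, ENNReal.ofReal_lt_ofReal_iff (by norm_num)] at h3
    have hsub : ENNReal.ofReal a - 1 = ENNReal.ofReal (a - 1) := by
      rw [ENNReal.ofReal_sub _ zero_le_one, ENNReal.ofReal_one]
    have hu : ((ENNReal.ofReal a)⁻¹).toReal = a⁻¹ := by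
      rw [ENNReal.toReal_inv, ENNReal.toReal_ofReal ha]
    have hhalf : ENNReal.ofReal (a - 1) / 2 = ENNReal.ofReal ((a - 1) / 2) := by
      rw [ENNReal.ofReal_div_of_pos two_pos, ENNReal.ofReal_ofNat]
    refine key ((a - 1) / 2) (by linarith) (by linarith) ?_ ?_ ?_
    · rw [hsub, ENNReal.ofReal_lt_ofReal_iff (by linarith)]
      linarith
    · rw [hsub, hhalf, min_eq_left]
      rw [ENNReal.ofReal_le_one]
      linarith
    · rw [hu]
      refine Gamma_ratio_le_of_third_lt ?_ (inv_lt_one_of_one_lt₀ ha1) (by rw [inv_inv])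
      rw [one_div]
      exact (inv_le_inv₀ (by norm_num) (by linarith)).2 ha3.le

end GammaBounds

/-! ### Transfer to the probability space of the representation. -/

section Representation

set_option linter.unusedSectionVars false

open Filter

variable {Ω 𝒳 𝒵 : Type*} [MeasurableSpace Ω] [MeasurableSpace 𝒳] [MeasurableSpace 𝒵]

/-- The points of the marked process, indexed by the natural numbers. -/
def pointSeq (Z : ℕ+ → Ω → 𝒵) (T : ℕ+ → Ω → ℝ) (ω : Ω) : (ℕ → ℝ) × (ℕ → 𝒵) :=
  (fun n => T n.succPNat ω, fun n => Z n.succPNat ω)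

lemma measurable_pointSeq {Z : ℕ+ → Ω → 𝒵} {T : ℕ+ → Ω → ℝ} (hZ : ∀ i, Measurable (Z i))
    (hT : ∀ i, Measurable (T i)) : Measurable (pointSeq Z T) :=
  (measurable_pi_iff.2 fun _ => hT _).prodMk (measurable_pi_iff.2 fun _ => hZ _)

lemma arrivalTimes_interarrival (T : ℕ+ → ℝ) (n : ℕ) :
    arrivalTimes (fun i => interarrival T i.succPNat) n = T n.succPNat := by
  induction n with
  | zero =>
    have h : Nat.succPNat 0 = 1 := rfl
    simp [arrivalTimes, interarrival, h]
  | succ n ih =>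
    have h1 : (n + 1).succPNat ≠ 1 := by
      intro h
      simpa using congrArg PNat.val h
    have h2 : (n + 1).succPNat - 1 = n.succPNat := by
      apply PNat.coe_injective
      rw [PNat.sub_coe, if_pos (PNat.coe_lt_coe _ _ |>.1 (by simp))]
      simp
    rw [arrivalTimes] at ih ⊢
    rw [Finset.sum_range_succ, ih, interarrival, if_neg h1, h2]
    ring

lemma IsPoissonArrivals.map_eq {μ : Measure Ω} [IsProbabilityMeasure μ] {T : ℕ+ → Ω → ℝ}
    (hT : IsPoissonArrivals μ T) :
    μ.map (fun ω (n : ℕ) => T n.succPNat ω) = arrivalLaw := by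
  have hm : ∀ n : ℕ, Measurable fun ω => interarrival (fun j => T j ω) n.succPNat := by
    intro n
    unfold interarrival
    have := hT.measurable
    split_ifs <;> fun_prop
  have h1 := (hT.indep_interarrival.precomp Nat.succPNat_injective).map_fun_eq_infinitePi_map hm
  have h2 : (fun n : ℕ => μ.map ((fun (i : ℕ+) ω => interarrival (fun j => T j ω) i) n.succPNat))
      = fun _ => expMeasure 1 := funext fun n => hT.law_interarrival _
  have h3 : (fun ω (n : ℕ) => T n.succPNat ω)
      = arrivalTimes ∘ fun ω (n : ℕ) => interarrival (fun j => T j ω) n.succPNat := by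
    funext ω n
    exact (arrivalTimes_interarrival (fun j => T j ω) n).symm
  rw [h3, ← Measure.map_map measurable_arrivalTimes (measurable_pi_iff.2 hm), arrivalLaw, ← h2]
  exact congrArg (Measure.map arrivalTimes) h1

lemma IsIIDSample.map_eq {μ : Measure Ω} {Q : Measure 𝒵} {Z : ℕ+ → Ω → 𝒵}
    (hZ : IsIIDSample μ Q Z) :
    μ.map (fun ω (n : ℕ) => Z n.succPNat ω) = Measure.infinitePi fun _ : ℕ => Q := by
  have h1 := (hZ.indep.precomp Nat.succPNat_injective).map_fun_eq_infinitePi_map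
    fun n => hZ.measurable _
  rw [h1]
  congr 1
  funext n
  exact hZ.law _

variable [MeasurableSpace.CountableOrCountablyGenerated 𝒳 𝒵]

/-- The jointly measurable density of a mechanism with respect to a proposal distribution. -/
noncomputable def mechanismDensity (κ : Kernel 𝒳 𝒵) (Q : Measure 𝒵) (x : 𝒳) (z : 𝒵) : ℝ≥0∞ :=
  Kernel.rnDeriv κ (Kernel.const 𝒳 Q) x z

lemma measurable_mechanismDensity (κ : Kernel 𝒳 𝒵) (Q : Measure 𝒵) :
    Measurable (Function.uncurry (mechanismDensity κ Q)) :=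
  Kernel.measurable_rnDeriv κ (Kernel.const 𝒳 Q)

variable {κ : Kernel 𝒳 𝒵} [IsMarkovKernel κ] {Q : Measure 𝒵} [IsProbabilityMeasure Q]

lemma mechanismDensity_ae_eq (κ : Kernel 𝒳 𝒵) [IsMarkovKernel κ] (Q : Measure 𝒵)
    [IsProbabilityMeasure Q] (x : 𝒳) : mechanismDensity κ Q x =ᵐ[Q] (κ x).rnDeriv Q := by
  have := Kernel.rnDeriv_eq_rnDeriv_measure (κ := κ) (η := Kernel.const 𝒳 Q) (a := x)
  rw [Kernel.const_apply] at this
  exact this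

lemma withDensity_mechanismDensity {x : 𝒳} (h : κ x ≪ Q) :
    Q.withDensity (mechanismDensity κ Q x) = κ x := by
  rw [withDensity_congr_ae (mechanismDensity_ae_eq κ Q x), Measure.withDensity_rnDeriv_eq _ _ h]

lemma lintegral_mechanismDensity {x : 𝒳} (h : κ x ≪ Q) : ∫⁻ z, mechanismDensity κ Q x z ∂Q = 1 := by
  rw [← setLIntegral_univ, ← withDensity_apply _ MeasurableSet.univ, withDensity_mechanismDensity h,
    measure_univ]

lemma klDiv_eq_lintegral_mechanismDensity {x : 𝒳} (h : κ x ≪ Q) :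
    klDiv (κ x) Q = ∫⁻ z, ENNReal.ofReal (klFun (mechanismDensity κ Q x z).toReal) ∂Q := by
  rw [klDiv_eq_lintegral_klFun_of_ac h]
  refine lintegral_congr_ae ?_
  filter_upwards [mechanismDensity_ae_eq κ Q x] with z hz
  rw [hz]

variable {μ : Measure Ω} [IsProbabilityMeasure μ] {α : ℝ≥0∞} {X : Ω → 𝒳} {Z : ℕ+ → Ω → 𝒵}
  {T : ℕ+ → Ω → ℝ} {K : Ω → ℕ+}

lemma IsPPR.measurable_pointSeq (h : IsPPR μ α κ Q X Z T K) : Measurable (pointSeq Z T) :=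
  _root_.measurable_pointSeq h.sample.measurable h.arrivals.measurable

lemma IsPPR.map_pointSeq (h : IsPPR μ α κ Q X Z T K) : μ.map (pointSeq Z T) = markedLaw Q := by
  have h1 := h.indep_sample_arrivals.symm.comp (φ := fun f (n : ℕ) => f n.succPNat)
    (ψ := fun f (n : ℕ) => f n.succPNat) (by fun_prop) (by fun_prop)
  have h2 := h1.map_prod_eq_prod_map_map
    (measurable_pi_iff.2 fun n => h.arrivals.measurable _).aemeasurable
    (measurable_pi_iff.2 fun n => h.sample.measurable _).aemeasurable
  rw [markedLaw, ← h.arrivals.map_eq, ← h.sample.map_eq]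
  exact h2

lemma IsPPR.map_input_pointSeq (h : IsPPR μ α κ Q X Z T K) :
    μ.map (fun ω => (X ω, pointSeq Z T ω)) = (μ.map X).prod (markedLaw Q) := by
  have h1 := h.indep_input.comp (φ := id)
    (ψ := fun p : (ℕ+ → 𝒵) × (ℕ+ → ℝ) => ((fun n : ℕ => p.2 n.succPNat, fun n : ℕ => p.1 n.succPNat)
      : (ℕ → ℝ) × (ℕ → 𝒵))) measurable_id (by fun_prop)
  rw [← h.map_pointSeq]
  exact h1.map_prod_eq_prod_map_map h.measurable_input.aemeasurable
    h.measurable_pointSeq.aemeasurable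

lemma IsPPR.lintegral_input_pointSeq (h : IsPPR μ α κ Q X Z T K)
    {F : 𝒳 → ((ℕ → ℝ) × (ℕ → 𝒵)) → ℝ≥0∞} (hF : Measurable (Function.uncurry F)) :
    ∫⁻ ω, F (X ω) (pointSeq Z T ω) ∂μ = ∫⁻ ω, ∫⁻ x, F (X ω) x ∂(markedLaw Q) ∂μ := by
  have h1 : ∫⁻ ω, F (X ω) (pointSeq Z T ω) ∂μ
      = ∫⁻ p, Function.uncurry F p ∂(μ.map fun ω => (X ω, pointSeq Z T ω)) :=
    (lintegral_map hF (h.measurable_input.prodMk h.measurable_pointSeq)).symm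
  rw [h1, h.map_input_pointSeq, lintegral_prod _ hF.aemeasurable,
    lintegral_map (Measurable.lintegral_prod_right' hF) h.measurable_input]
  rfl

lemma measurable_uncurry_scaledTimes (κ : Kernel 𝒳 𝒵) (Q : Measure 𝒵) :
    Measurable fun p : 𝒳 × ((ℕ → ℝ) × (ℕ → 𝒵)) => scaledTimes (mechanismDensity κ Q p.1) p.2 := by
  refine measurable_pi_iff.2 fun n => ?_
  exact Measurable.div (by fun_prop)
    (measurable_uncurry_comp (measurable_mechanismDensity κ Q) (by fun_prop) (by fun_prop))

lemma IsSelectionRule.measurable_uncurry_selectProb {Ψ : ℝ≥0∞ → (ℕ → ℝ≥0∞) → ℝ≥0∞}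
    (hΨ : IsSelectionRule Ψ) (κ : Kernel 𝒳 𝒵) (Q : Measure 𝒵) (k : ℕ) :
    Measurable fun p : 𝒳 × ((ℕ → ℝ) × (ℕ → 𝒵)) =>
      selectProb Ψ (mechanismDensity κ Q p.1) p.2 k :=
  measurable_uncurry_comp hΨ.measurable
    ((measurable_pi_apply k).comp (measurable_uncurry_scaledTimes κ Q))
    ((measurable_removeAt k).comp (measurable_uncurry_scaledTimes κ Q))

/-- Almost surely, some rescaled time is finite. -/
lemma IsPPR.ae_exists_scaledTimes_ne_top (h : IsPPR μ α κ Q X Z T K) :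
    ∀ᵐ ω ∂μ, ∃ n, scaledTimes (mechanismDensity κ Q (X ω)) (pointSeq Z T ω) n ≠ ∞ := by
  classical
  set S : Set (𝒳 × ((ℕ → ℝ) × (ℕ → 𝒵))) :=
    {p | ∀ n, scaledTimes (mechanismDensity κ Q p.1) p.2 n = ∞} with hS
  have hSm : MeasurableSet S := by
    rw [hS, Set.ofPred_forall]
    exact MeasurableSet.iInter fun n => measurableSet_eq_fun
      ((measurable_pi_apply n).comp (measurable_uncurry_scaledTimes κ Q)) measurable_const
  have h0 := h.lintegral_input_pointSeq (F := fun ξ x => S.indicator 1 (ξ, x))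
    (measurable_one.indicator hSm)
  have h1 : ∀ᵐ ω ∂μ, ∫⁻ x, S.indicator 1 (X ω, x) ∂(markedLaw Q) = 0 := by
    filter_upwards [h.absolutelyContinuous] with ω hω
    -- If all rescaled times are infinite, none precedes `t`, for any `t`; the void probability e⁻ᵗ
    -- tends to zero.
    have hle : ∀ t : ℝ, 0 < t → ∫⁻ x, S.indicator 1 (X ω, x) ∂(markedLaw Q)
        ≤ ENNReal.ofReal (Real.exp (-t)) := by
      intro t ht
      refine le_trans ?_ (measure_forall_le_scaledTimes_le Q
        ((measurable_mechanismDensity κ Q).comp measurable_prodMk_left)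
        (lintegral_mechanismDensity hω) ht)
      have e : ∫⁻ x, S.indicator (1 : 𝒳 × ((ℕ → ℝ) × (ℕ → 𝒵)) → ℝ≥0∞) (X ω, x) ∂(markedLaw Q)
          = markedLaw Q (Prod.mk (X ω) ⁻¹' S) := by
        rw [← lintegral_indicator_one (measurable_prodMk_left hSm)]
        rfl
      rw [e]
      refine measure_mono fun x hx n => ?_
      have hx : ∀ n, scaledTimes (mechanismDensity κ Q (X ω)) x n = ∞ := hx
      exact (hx n).symm ▸ le_top
    have hlim : Tendsto (fun t : ℝ => ENNReal.ofReal (Real.exp (-t))) atTop (nhds 0) := by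
      simpa using ENNReal.tendsto_ofReal Real.tendsto_exp_neg_atTop_nhds_zero
    refine le_zero_iff.1 (ge_of_tendsto hlim ?_)
    filter_upwards [eventually_gt_atTop 0] with t ht using hle t ht
  have hm : Measurable fun ω => S.indicator (1 : 𝒳 × ((ℕ → ℝ) × (ℕ → 𝒵)) → ℝ≥0∞) (X ω, pointSeq Z T ω) :=
    (measurable_one.indicator hSm).comp (h.measurable_input.prodMk h.measurable_pointSeq)
  rw [lintegral_congr_ae h1, lintegral_zero, lintegral_eq_zero_iff hm] at h0
  filter_upwards [h0] with ω hω
  by_contra! hcon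
  have hmem : (X ω, pointSeq Z T ω) ∈ S := hcon
  simp [Set.indicator_of_mem hmem] at hω

/-- The selection rule of the Poisson private representation with parameter `α`. -/
noncomputable def pprRule (α : ℝ≥0∞) : ℝ≥0∞ → (ℕ → ℝ≥0∞) → ℝ≥0∞ :=
  if α = ∞ then argminRule else powerRule α.toReal

lemma isSelectionRule_pprRule (hα : 1 < α) : IsSelectionRule (pprRule α) := by
  unfold pprRule
  split_ifs with h
  · exact isSelectionRule_argminRule
  · exact isSelectionRule_powerRule (ENNReal.toReal_pos (zero_lt_one.trans hα).ne' h)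

/-- Ties are harmless: every minimiser gets weight one and only an upper bound is claimed. The rule
gives no weight to infinite times, so the existence of a finite one is needed. -/
lemma IsPPR.measure_index_le_of_eq_top (h : IsPPR μ ∞ κ Q X Z T K) (k : ℕ) :
    μ (K ⁻¹' {k.succPNat})
      ≤ ∫⁻ ω, selectProb argminRule (mechanismDensity κ Q (X ω)) (pointSeq Z T ω) k ∂μ := by
  rw [← lintegral_indicator_one (h.measurable_index _)]
  refine lintegral_mono_ae ?_
  filter_upwards [h.argmin_index rfl, h.ae_exists_scaledTimes_ne_top] with ω hω hfin
  by_cases hK : K ω = k.succPNat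
  · rw [hK] at hω
    have hmin : ∀ n, scaledTimes (mechanismDensity κ Q (X ω)) (pointSeq Z T ω) k
        ≤ scaledTimes (mechanismDensity κ Q (X ω)) (pointSeq Z T ω) n := fun n => hω n.succPNat
    obtain ⟨n, hn⟩ := hfin
    have : selectProb argminRule (mechanismDensity κ Q (X ω)) (pointSeq Z T ω) k = 1 :=
      if_pos ⟨ne_top_of_le_ne_top hn (hmin n), fun n => hmin _⟩
    rw [this]
    exact Set.indicator_le_self' (fun _ _ => zero_le_one) ω
  · rw [Set.indicator_of_notMem (by simpa using hK)]
    exact zero_le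

lemma IsPPR.measure_index_le_of_ne_top (h : IsPPR μ α κ Q X Z T K) (hα : α ≠ ∞) (k : ℕ) :
    μ (K ⁻¹' {k.succPNat})
      ≤ ∫⁻ ω, selectProb (powerRule α.toReal) (mechanismDensity κ Q (X ω)) (pointSeq Z T ω) k
          ∂μ := by
  have hm : Measurable fun ω => (X ω, (fun i => Z i ω : ℕ+ → 𝒵), (fun i => T i ω : ℕ+ → ℝ)) :=
    h.measurable_input.prodMk ((measurable_pi_iff.2 h.sample.measurable).prodMk
      (measurable_pi_iff.2 h.arrivals.measurable))
  set p : Ω → ℝ := fun ω => selectionProb α.toReal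
    (fun i => scaledTime κ Q (X ω) (Z i ω) (T i ω)) k.succPNat
  have hcond := h.condDistrib_index hα k.succPNat
  have hint := integral_condExp (μ := μ) (f := (K ⁻¹' {k.succPNat}).indicator fun _ => (1 : ℝ))
    hm.comap_le
  rw [integral_congr_ae hcond, integral_indicator_const _ (h.measurable_index _), smul_eq_mul,
    mul_one] at hint
  have hpi : Integrable p μ := (integrable_congr hcond).1 integrable_condExp
  calc μ (K ⁻¹' {k.succPNat}) = ENNReal.ofReal (∫ ω, p ω ∂μ) := by
        rw [hint, ofReal_measureReal]
    _ = ∫⁻ ω, ENNReal.ofReal (p ω) ∂μ :=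
        ofReal_integral_eq_lintegral_ofReal hpi (ae_of_all _ fun ω => ENNReal.toReal_nonneg)
    _ ≤ _ := by
        refine lintegral_mono fun ω => ENNReal.ofReal_toReal_le.trans (le_of_eq ?_)
        set σ := scaledTimes (mechanismDensity κ Q (X ω)) (pointSeq Z T ω)
        change σ k ^ (-α.toReal) / (∑' i : ℕ+, _) = _
        rw [selectProb, powerRule,
          show σ k ^ (-α.toReal) + ∑' n, removeAt k σ n ^ (-α.toReal) = ∑' n, σ n ^ (-α.toReal) from
            (tsum_eq_add_tsum_removeAt (fun n => σ n ^ (-α.toReal)) k).symm,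
          ← Equiv.pnatEquivNat.symm.tsum_eq]
        rfl

lemma IsPPR.measure_index_le (h : IsPPR μ α κ Q X Z T K) (k : ℕ) :
    μ (K ⁻¹' {k.succPNat})
      ≤ ∫⁻ ω, selectProb (pprRule α) (mechanismDensity κ Q (X ω)) (pointSeq Z T ω) k ∂μ := by
  unfold pprRule
  split_ifs with hα
  · subst hα
    exact h.measure_index_le_of_eq_top k
  · exact h.measure_index_le_of_ne_top hα k

lemma lintegral_comp_pnat (hK : ∀ k, MeasurableSet (K ⁻¹' {k})) (f : ℕ+ → ℝ≥0∞) :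
    ∫⁻ ω, f (K ω) ∂μ = ∑' k : ℕ, f k.succPNat * μ (K ⁻¹' {k.succPNat}) := by
  have h1 : ∀ ω, f (K ω) = ∑' k : ℕ+, (K ⁻¹' {k}).indicator (fun _ => f k) ω := by
    intro ω
    rw [tsum_eq_single (K ω)]
    · simp
    · intro k hk
      exact Set.indicator_of_notMem (by simpa using hk.symm) _
  simp_rw [h1]
  rw [lintegral_tsum fun k => (measurable_const.indicator (hK k)).aemeasurable,
    ← Equiv.pnatEquivNat.symm.tsum_eq]
  congr 1
  funext k
  rw [lintegral_indicator_const (hK _)]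
  rfl

/-- The density is chosen before `Q` and `r`, so one choice serves all inputs at once. -/
lemma pprRule_bound {η : ℝ} (hα : 1 < α) (hη : 0 < η) (hηα : ENNReal.ofReal η < α - 1) :
    ∃ d : ℝ → ℝ≥0∞, Measurable d ∧ ∫⁻ t in Set.Ioi 0, d t = 1 ∧
      ∫⁻ t in Set.Ioi 0, ENNReal.ofReal (t ^ η) * d t
        = ENNReal.ofReal (Real.Gamma (1 - (η + 1) * (α⁻¹).toReal) * Real.Gamma (η + 1)
          / Real.Gamma (1 - (α⁻¹).toReal) ^ (η + 1)) ∧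
      ∀ (Q : Measure 𝒵) [IsProbabilityMeasure Q] (r : 𝒵 → ℝ≥0∞), Measurable r →
        ∫⁻ z, r z ∂Q = 1 → ∀ t, 0 < t →
          ∫⁻ x, pprRule α (ENNReal.ofReal t) (scaledTimes r x) ∂(markedLaw Q) ≤ d t := by
  unfold pprRule
  split_ifs with h
  · subst h
    refine ⟨fun t => ENNReal.ofReal (Real.exp (-t)), by fun_prop, lintegral_exp_neg_Ioi, ?_,
      fun Q _ r hr hr_int t ht => lintegral_argminRule_le Q hr hr_int ht⟩
    rw [lintegral_rpow_mul_exp_neg hη.le]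
    simp
  · have hα1 : 1 < α.toReal := by
      rw [← ENNReal.toReal_one]
      exact (ENNReal.toReal_lt_toReal ENNReal.one_ne_top h).2 hα
    have hηα' : η + 1 < α.toReal := by
      have h1 : ENNReal.ofReal (η + 1) < α := by
        rw [ENNReal.ofReal_add hη.le zero_le_one, ENNReal.ofReal_one]
        exact lt_tsub_iff_right.1 hηα
      exact (ENNReal.ofReal_lt_iff_lt_toReal (by positivity) h).1 h1
    rw [ENNReal.toReal_inv]
    refine ⟨powerDensity α.toReal, measurable_powerDensity _, ?_,
      lintegral_rpow_mul_powerDensity hη.le hηα',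
      fun Q _ r hr hr_int t ht => lintegral_powerRule_le Q hr hr_int hα1 ht⟩
    -- The zeroth moment is the normalisation of the density.
    have h0 := lintegral_rpow_mul_powerDensity le_rfl ((zero_add (1 : ℝ)).symm ▸ hα1)
    have hΓ : 0 < Real.Gamma (1 - α.toReal⁻¹) :=
      Real.Gamma_pos_of_pos (sub_pos.2 (inv_lt_one_of_one_lt₀ hα1))
    simpa [hΓ.ne'] using h0

/-- The bound on `E[log K]`, averaged over the input. -/
theorem IsPPR.expectedLog_le (h : IsPPR μ α κ Q X Z T K) (hα : 1 < α) {b : ℝ} (hb : 1 < b) :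
    expectedLog b μ K
      ≤ (∫⁻ ω, klDiv (κ (X ω)) Q ∂μ) / ENNReal.ofReal (Real.log b) + gammaBound b α := by
  have hlogb : 0 < Real.log b := Real.log_pos hb
  -- With the divergence subtracted, the bound by the infimum is checked for each η; truncated
  -- subtraction also covers an infinite divergence.
  rw [← tsub_le_iff_left]
  refine le_iInf₂ fun η ⟨hη, hη1, hηα⟩ => ?_
  rw [tsub_le_iff_left]
  set C := Real.Gamma (1 - (η + 1) * (α⁻¹).toReal) * Real.Gamma (η + 1)
        / Real.Gamma (1 - (α⁻¹).toReal) ^ (η + 1)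
  have hC : 0 ≤ C := gamma_ratio_nonneg hα hη hηα
  obtain ⟨d, hd, hd1, hdη, hdΨ⟩ := pprRule_bound (𝒵 := 𝒵) hα hη hηα
  have hΨ := isSelectionRule_pprRule hα
  have hlog : ENNReal.ofReal (1 / η * Real.logb b (C + 1))
      = ENNReal.ofReal (Real.log (1 + C) / η) / ENNReal.ofReal (Real.log b) := by
    rw [← ENNReal.ofReal_div_of_pos hlogb, Real.logb, add_comm C]
    congr 1
    ring
  rw [hlog, ← ENNReal.add_div, ENNReal.le_div_iff_mul_le (by simp [hlogb]) (by simp)]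
  have hF : ∀ k : ℕ, Measurable fun p : 𝒳 × ((ℕ → ℝ) × (ℕ → 𝒵)) =>
      ENNReal.ofReal (Real.log (k + 1)) * selectProb (pprRule α) (mechanismDensity κ Q p.1) p.2 k :=
    fun k => (hΨ.measurable_uncurry_selectProb κ Q k).const_mul _
  have hFω : ∀ k : ℕ, Measurable fun ω => ENNReal.ofReal (Real.log (k + 1))
      * selectProb (pprRule α) (mechanismDensity κ Q (X ω)) (pointSeq Z T ω) k :=
    fun k => (hF k).comp (h.measurable_input.prodMk h.measurable_pointSeq)
  calc expectedLog b μ K * ENNReal.ofReal (Real.log b)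
      = ∫⁻ ω, ENNReal.ofReal (Real.log ((K ω : ℕ) : ℝ)) ∂μ := by
        rw [expectedLog, ← lintegral_mul_const' _ _ ENNReal.ofReal_ne_top]
        refine lintegral_congr fun ω => ?_
        rw [← ENNReal.ofReal_mul (Real.logb_nonneg hb (by exact_mod_cast one_le)), Real.logb,
          div_mul_cancel₀ _ hlogb.ne']
    _ = ∑' k : ℕ, ENNReal.ofReal (Real.log (k + 1)) * μ (K ⁻¹' {k.succPNat}) := by
        rw [lintegral_comp_pnat h.measurable_index
          fun k : ℕ+ => ENNReal.ofReal (Real.log ((k : ℕ) : ℝ))]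
        simp
    _ ≤ ∑' k : ℕ, ENNReal.ofReal (Real.log (k + 1)) * ∫⁻ ω,
          selectProb (pprRule α) (mechanismDensity κ Q (X ω)) (pointSeq Z T ω) k ∂μ := by
        gcongr with k
        exact h.measure_index_le k
    _ = ∫⁻ ω, ∑' k : ℕ, ENNReal.ofReal (Real.log (k + 1))
          * selectProb (pprRule α) (mechanismDensity κ Q (X ω)) (pointSeq Z T ω) k ∂μ := by
        rw [lintegral_tsum fun k => (hFω k).aemeasurable]
        simp_rw [lintegral_const_mul' _ _ ENNReal.ofReal_ne_top]
    _ = ∫⁻ ω, ∫⁻ x, ∑' k : ℕ, ENNReal.ofReal (Real.log (k + 1))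
          * selectProb (pprRule α) (mechanismDensity κ Q (X ω)) x k ∂(markedLaw Q) ∂μ :=
        h.lintegral_input_pointSeq (F := fun ξ x => ∑' k : ℕ, ENNReal.ofReal (Real.log (k + 1))
          * selectProb (pprRule α) (mechanismDensity κ Q ξ) x k) (Measurable.tsum hF)
    _ ≤ ∫⁻ ω, (klDiv (κ (X ω)) Q + ENNReal.ofReal (Real.log (1 + C) / η)) ∂μ := by
        refine lintegral_mono_ae ?_
        filter_upwards [h.absolutelyContinuous] with ω hω
        have hr : Measurable (mechanismDensity κ Q (X ω)) :=
          (measurable_mechanismDensity κ Q).comp measurable_prodMk_left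
        rw [klDiv_eq_lintegral_mechanismDensity hω]
        exact hΨ.lintegral_log_index_le Q hr (lintegral_mechanismDensity hω) hη hη1 hC hd hd1 hdη
          (hdΨ Q _ hr (lintegral_mechanismDensity hω))
    _ = _ := by
        rw [lintegral_add_right _ measurable_const]
        simp

/-- The averaged divergence is the divergence of the joint distributions. -/
lemma lintegral_klDiv_eq_klDiv_compProd (hX : Measurable X) (h : ∀ᵐ ω ∂μ, κ (X ω) ≪ Q) :
    ∫⁻ ω, klDiv (κ (X ω)) Q ∂μ = klDiv (μ.map X ⊗ₘ κ) ((μ.map X).prod Q) := by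
  have : IsProbabilityMeasure (μ.map X) := Measure.isProbabilityMeasure_map hX.aemeasurable
  have hm := measurable_mechanismDensity κ Q
  -- The joint density of the mechanism is the density of the joint law with respect to the product;
  -- Tonelli applied to `klFun` of it then gives the equality.
  have hw : ((μ.map X).prod Q).withDensity (Function.uncurry (mechanismDensity κ Q))
      = μ.map X ⊗ₘ κ := by
    ext s hs
    have hi : Measurable (s.indicator (Function.uncurry (mechanismDensity κ Q))) := hm.indicator hs
    rw [withDensity_apply _ hs, ← lintegral_indicator hs, lintegral_prod _ hi.aemeasurable,
      Measure.compProd_apply hs, lintegral_map hi.lintegral_prod_right' hX,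
      lintegral_map (Kernel.measurable_kernel_prodMk_left hs) hX]
    refine lintegral_congr_ae ?_
    filter_upwards [h] with ω hω
    rw [← withDensity_mechanismDensity hω, withDensity_apply _ (measurable_prodMk_left hs),
      ← lintegral_indicator (measurable_prodMk_left hs)]
    rfl
  have hac : μ.map X ⊗ₘ κ ≪ (μ.map X).prod Q := hw ▸ withDensity_absolutelyContinuous _ _
  have hd : (μ.map X ⊗ₘ κ).rnDeriv ((μ.map X).prod Q)
      =ᵐ[(μ.map X).prod Q] Function.uncurry (mechanismDensity κ Q) :=
    hw ▸ Measure.rnDeriv_withDensity _ hm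
  have hkm : Measurable fun p => ENNReal.ofReal
      (klFun (Function.uncurry (mechanismDensity κ Q) p).toReal) :=
    (measurable_klFun.comp hm.ennreal_toReal).ennreal_ofReal
  rw [klDiv_eq_lintegral_klFun_of_ac hac, lintegral_congr_ae (g := fun p =>
      ENNReal.ofReal (klFun (Function.uncurry (mechanismDensity κ Q) p).toReal)) (by
    filter_upwards [hd] with p hp
    rw [hp]), lintegral_prod _ hkm.aemeasurable, lintegral_map hkm.lintegral_prod_right' hX]
  refine lintegral_congr_ae ?_
  filter_upwards [h] with ω hω
  exact klDiv_eq_lintegral_mechanismDensity hω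

end Representation

/-! ### The theorem for fixed and for random input. -/

theorem mainTheorem8
    {Ω 𝒳 𝒵 : Type*} [MeasurableSpace Ω] [MeasurableSpace 𝒳] [MeasurableSpace 𝒵]
    [MeasurableSpace.CountableOrCountablyGenerated 𝒳 𝒵]
    (μ : Measure Ω) [IsProbabilityMeasure μ]
    (κ : Kernel 𝒳 𝒵) [IsMarkovKernel κ]
    (α : ℝ≥0∞) (hα : 1 < α) (b : ℝ) (hb : 1 < b)
    (Z : ℕ+ → Ω → 𝒵) (T : ℕ+ → Ω → ℝ) (K : Ω → ℕ+) :
    (∀ (Q : Measure 𝒵) [IsProbabilityMeasure Q] (x : 𝒳),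
      IsPPR μ α κ Q (fun _ => x) Z T K →
        expectedLog b μ K ≤ klDivBase b (κ x) Q + gammaBound b α ∧
        klDivBase b (κ x) Q + gammaBound b α ≤ klDivBase b (κ x) Q + simpleBound b α) ∧
    (∀ X : Ω → 𝒳,
      IsPPR μ α κ (κ ∘ₘ μ.map X) X Z T K →
        expectedLog b μ K ≤ mutualInfo b (μ.map X ⊗ₘ κ) + simpleBound b α) := by
  refine ⟨fun Q _ x h => ⟨?_, add_le_add_right (gammaBound_le_simpleBound hb hα) _⟩, fun X h => ?_⟩
  · have := h.expectedLog_le hα hb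
    rwa [lintegral_const, measure_univ, mul_one] at this
  · have hX : Measurable X := h.measurable_input
    have : IsProbabilityMeasure (μ.map X) := Measure.isProbabilityMeasure_map hX.aemeasurable
    have hbound := h.expectedLog_le hα hb
    rw [lintegral_klDiv_eq_klDiv_compProd hX h.absolutelyContinuous] at hbound
    refine hbound.trans (add_le_add (le_of_eq ?_) (gammaBound_le_simpleBound hb hα))
    -- The proposal is the second marginal of the joint law, so the divergence from the product is
    -- the mutual information.
    rw [mutualInfo, klDivBase, Measure.fst_compProd, Measure.snd_compProd]
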